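/- **Setting.** A labelled graph is a finite directed graph whose vertices and edges carry sets of labels. Let $q$ be a query graph with $n\ge 1$ vertices, without self-loops and without isolated vertices, and let $g$ be a data graph. An edge $d$ of $g$ *matches* an edge $e$ of $q$ if the label sets of $d$ and of its two endpoints contain those of $e$ and of its corresponding endpoints; $R_e$ denotes the set of edges of $g$ matching $e$. An *embedding* of $q$ in $g$ is a graph homomorphism $V_q\to V_g$ such that the label sets of image vertices and edges contain those of the vertices and edges of $q$; $\mathcal M$ is the set of all embeddings. Let $AGM(q)=\inf_x\prod_{e\in E_q}|R_e|^{x_e}$, where $x$ ranges over the fractional edge covers of $q$ ($x_e\ge 0$ and $\sum_{e\ni u}x_e\ge 1$ for every $u\in V_q$). **The estimator Alley.** Fix a branching factor $b\in(0,1)$ and an ordering $o_1,\dots,o_n$ of $V_q$. For a mapping $p$ of $o_1,\dots,o_{i-1}$ to vertices of $g$, let $P_{o_i}$ be the intersection, over the query edges $e$ joining $o_i$ to some $o_k$, of the following index lists: for $k<i$, the neighbours of $p(o_k)$ along edges of $g$ matching $e$; for $k>i$, the vertices of $g$ that are the endpoint corresponding to $o_i$ of some edge matching $e$. The intersection is computed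 by scanning a shortest list and testing membership in the others. Put $a_i=|P_{o_i}|$ and $t_i=\lceil b\,a_i\rceil$. Starting from $i=1$ and the empty mapping, the random walk returns $Y_n=a_n$ at depth $i=n$; at depth $i<n$ it samples $t_i$ vertices $v$ of $P_{o_i}$ uniformly without replacement, continues recursively from $p\cup\{o_i\to v\}$ for each of them, and returns $Y_i=\frac{a_i}{t_i}\sum_{k=1}^{t_i}Y_{i+1}^{k}$ ($Y_i=0$ if $a_i=0$). For an error bound $\epsilon>0$ and a confidence $\mu\in(0,1)$, Alley returns the average $Z$ of $$h=\left\lceil\frac{\frac{b}{1-b}\left(\frac1{b^n}-1\right)}{\epsilon^2(1-\mu)}\right\rceil$$ independent copies of $Y_1$. Time is counted in unit-cost steps: looking up an index list and its length, a membership test in an index list, an array access, a random draw, a recursive call and an arithmetic operation cost one step each; the index of $g$ and the ordering are given. **Theorem.** Let $b\in(0,1)$, $n\ge 1$, $\epsilon>0$ and $\mu\in(0,1)$. There is a constant $C$, depending only on $b,n,\epsilon,\mu$, such that for every such $q$ with $n$ vertices, every $g$ and every ordering of $V_q$: 1. if $|\mathcal M|>0$, then $Z$ is a $(1\pm\epsilon)$-approximation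 of $|\mathcal M|$ with confidence $\mu$, i.e. $\Pr\big(|Z-|\mathcal M||<\epsilon\,|\mathcal M|\big)>\mu$; 2. if every $R_e$ is nonempty (in particular if $|\mathcal M|>0$), then every run of Alley, whatever its random draws, takes at most $C\cdot AGM(q)$ steps. -/

import Mathlib

/-! ### Labelled graphs, embeddings and the AGM bound -/

/-- A finite directed labelled graph: vertices and edges carry sets of labels.
(Undirected graphs are the symmetric ones; unlabelled graphs have empty label sets; a single
label per vertex or edge is a singleton.) -/
structure LabeledGraph (V Λ : Type) where
  /-- the directed edges -/
  edges : Finset (V × V)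
  /-- the labels of a vertex -/
  vlabel : V → Set Λ
  /-- the labels of an edge (relevant only on `edges`) -/
  elabel : V × V → Set Λ

namespace LabeledGraph

variable {U V Λ : Type}

/-- The edge `e` is incident to the vertex `u`. -/
def Incident (e : U × U) (u : U) : Prop := e.1 = u ∨ e.2 = u

/-- The data edge `d` matches the query edge `e`: it is an edge of `g` whose labels, and the labels
of whose endpoints, include those required by the query. -/
def Matches (q : LabeledGraph U Λ) (g : LabeledGraph V Λ) (e : U × U) (d : V × V) : Prop :=
  d ∈ g.edges ∧ q.elabel e ⊆ g.elabel d ∧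
    q.vlabel e.1 ⊆ g.vlabel d.1 ∧ q.vlabel e.2 ⊆ g.vlabel d.2

/-- An embedding of `q` in `g`: a label-respecting graph homomorphism. -/
def IsEmbedding (q : LabeledGraph U Λ) (g : LabeledGraph V Λ) (m : U → V) : Prop :=
  (∀ u, q.vlabel u ⊆ g.vlabel (m u)) ∧
    ∀ e ∈ q.edges, (m e.1, m e.2) ∈ g.edges ∧ q.elabel e ⊆ g.elabel (m e.1, m e.2)

open Classical in
/-- The set of all embeddings of `q` in `g`. -/
noncomputable def embeddings [Fintype U] [Fintype V] (q : LabeledGraph U Λ) (g : LabeledGraph V Λ) :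
    Finset (U → V) :=
  Finset.univ.filter fun m => IsEmbedding q g m

open Classical in
/-- The relation of a query edge: all data edges that match it. -/
noncomputable def rel (q : LabeledGraph U Λ) (g : LabeledGraph V Λ) (e : U × U) : Finset (V × V) :=
  g.edges.filter fun d => Matches q g e d

open Classical in
/-- `x` is a fractional edge cover of `q`. -/
def IsFractionalEdgeCover (q : LabeledGraph U Λ) (x : U × U → ℝ) : Prop :=
  (∀ e ∈ q.edges, 0 ≤ x e) ∧ ∀ u, 1 ≤ ∑ e ∈ q.edges.filter (fun e => Incident e u), x e

/-- The AGM bound of `q` on `g`: the least value of `∏ |R_e| ^ x_e` over all fractional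
edge covers `x` of `q`. -/
noncomputable def AGM (q : LabeledGraph U Λ) (g : LabeledGraph V Λ) : ℝ :=
  sInf {c : ℝ | ∃ x : U × U → ℝ, IsFractionalEdgeCover q x ∧
    c = ∏ e ∈ q.edges, ((rel q g e).card : ℝ) ^ x e}

end LabeledGraph

/-! ### Randomised computations with a step counter -/

/-- A randomised computation: the joint law of its result and of the number of elementary steps
that it takes. -/
def RandM (α : Type) : Type := PMF (α × ℕ)

namespace RandM

/-- Running one computation after the other adds up the numbers of steps. -/
noncomputable instance : Monad RandM where
  pure a := PMF.pure (a, 0)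
  bind x f := PMF.bind x fun r => PMF.map (fun s => (s.1, r.2 + s.2)) (f r.1)

/-- Charge `k` elementary steps. -/
noncomputable def step (k : ℕ) : RandM Unit := PMF.pure ((), k)

/-- Draw a uniformly distributed element of `{0, …, k}`, in one step. -/
noncomputable def draw (k : ℕ) : RandM (Fin (k + 1)) :=
  PMF.map (fun j => (j, 1)) (PMF.uniformOfFintype (Fin (k + 1)))

/-- The law of the result. -/
noncomputable def result {α : Type} (x : RandM α) : PMF α := PMF.map Prod.fst x

/-- Every run of the computation takes at most `B` steps, whatever the outcome of its
random draws. -/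
def TimeLE {α : Type} (x : RandM α) (B : ℝ) : Prop := ∀ r ∈ PMF.support x, ((r.2 : ℕ) : ℝ) ≤ B

end RandM

/-! ### The estimator

Unit-cost model: one step each for looking up an index list with its length, reading
or writing an array entry, testing membership in an index list, a random draw, a recursive call, and
an arithmetic operation or comparison. -/

namespace Alley

open LabeledGraph RandM

variable {U V Λ : Type}

open Classical in
/-- The index list that the query edge `e`, incident to `u`, provides for `u` under the partial
mapping `p`. If the other endpoint is mapped to `w`, these are the neighbours of `w` along data
edges that match `e`; otherwise these are all endpoints, on the side of `u`, of data edges that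
match `e`. -/
noncomputable def indexList [Fintype V] (q : LabeledGraph U Λ) (g : LabeledGraph V Λ)
    (p : U → Option V) (u : U) (e : U × U) : Finset V :=
  if e.1 = u then
    match p e.2 with
    | some w => Finset.univ.filter fun v => Matches q g e (v, w)
    | none => Finset.univ.filter fun v => ∃ w, Matches q g e (v, w)
  else
    match p e.1 with
    | some w => Finset.univ.filter fun v => Matches q g e (w, v)
    | none => Finset.univ.filter fun v => ∃ w, Matches q g e (w, v)

open Classical in
/-- The index lists for `u`, one for each query edge incident to `u`. -/
noncomputable def indexLists [Fintype V] (q : LabeledGraph U Λ) (g : LabeledGraph V Λ)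
    (p : U → Option V) (u : U) : List (Finset V) :=
  (q.edges.filter fun e => Incident e u).toList.map (indexList q g p u)

/-- Scan index lists for one of smallest length; `S` is the shortest list seen so far. -/
noncomputable def smallest (S : Finset V) : List (Finset V) → RandM (Finset V)
  | [] => pure S
  | T :: Ts => do
    step 2
    smallest (if T.card < S.card then T else S) Ts

open Classical in
/-- Test whether `v` lies in all the given index lists. -/
noncomputable def memAll (v : V) : List (Finset V) → RandM Bool
  | [] => pure true
  | T :: Ts => do
    step 1
    if v ∈ T then memAll v Ts else pure false

/-- Keep the entries of an array that lie in all the index lists `Ts`. -/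
noncomputable def filterBy (Ts : List (Finset V)) : List V → RandM (List V)
  | [] => pure []
  | v :: vs => do
    step 1
    let keep ← memAll v Ts
    let rest ← filterBy Ts vs
    if keep then do
      step 1
      pure (v :: rest)
    else pure rest

/-- Intersect a nonempty family of index lists, by scanning a shortest one. -/
noncomputable def intersect : List (Finset V) → RandM (List V)
  | [] => pure []
  | T :: Ts => do
    step 2
    let S ← smallest T Ts
    filterBy (T :: Ts) S.toList

/-- Remove the entry at position `j` from an array by overwriting it with the last entry. -/
def swapRemove (A : List V) (j : ℕ) : List V :=
  match A.getLast? with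
  | none => []
  | some z => (A.set j z).dropLast

/-- Sample `t` entries of an array uniformly without replacement. -/
noncomputable def sample : ℕ → List V → RandM (List V)
  | 0, _ => pure []
  | _ + 1, [] => pure []
  | t + 1, a :: A => do
    let j ← draw A.length
    step 4
    let rest ← sample t (swapRemove (a :: A) j)
    pure ((a :: A).get j :: rest)

/-- Add up the results of running `f` on all entries of an array. -/
noncomputable def sumOver (f : V → RandM ℝ) : List V → RandM ℝ
  | [] => pure 0
  | v :: vs => do
    step 3
    let w ← f v
    let s ← sumOver f vs
    step 1
    pure (w + s)

open Classical in
/-- The random walk with intersection and branching factor `b`. The list holds the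
query vertices that are still to be mapped, in the sampling order; `p` is the current partial
mapping. -/
noncomputable def walk [Fintype V] (q : LabeledGraph U Λ) (g : LabeledGraph V Λ) (b : ℝ) :
    List U → (U → Option V) → RandM ℝ
  | [], _ => pure 1
  | [u], p => do
    let P ← intersect (indexLists q g p u)
    step 1
    pure (P.length : ℝ)
  | u :: u' :: us, p => do
    let P ← intersect (indexLists q g p u)
    let t := ⌈b * (P.length : ℝ)⌉₊
    step 2
    let S ← sample t P
    let s ← sumOver (fun v => walk q g b (u' :: us) (Function.update p u (some v))) S
    step 2
    pure ((P.length : ℝ) * (1 / (t : ℝ)) * s)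

/-- The sum of the results of `h` independent runs of `x`. -/
noncomputable def sumRuns (x : RandM ℝ) : ℕ → RandM ℝ
  | 0 => pure 0
  | h + 1 => do
    step 1
    let w ← x
    let s ← sumRuns x h
    step 1
    pure (w + s)

/-- The number of independent random walks that are averaged, for `n` query vertices, branching
factor `b`, error bound `ε` and confidence `μ`. -/
noncomputable def numRuns (b : ℝ) (n : ℕ) (ε μ : ℝ) : ℕ :=
  ⌈b / (1 - b) * (1 / b ^ n - 1) / (ε ^ 2 * (1 - μ))⌉₊

/-- The estimator: the average of `h` independent random walks along the sampling order `o`. -/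
noncomputable def estimate [Fintype V] (q : LabeledGraph U Λ) (g : LabeledGraph V Λ) (b : ℝ)
    (o : List U) (h : ℕ) : RandM ℝ := do
  let s ← sumRuns (walk q g b o fun _ => none) h
  step 1
  pure (s / (h : ℝ))

/-- A random estimate with law `Z` is a `(1 ± ε)`-approximation of `N` with confidence `μ`. -/
def IsApproximation (ε μ : ℝ) (Z : PMF ℝ) (N : ℕ) : Prop :=
  μ < (Z.toMeasure {z : ℝ | |z - (N : ℝ)| < ε * (N : ℝ)}).toReal

end Alley

/-! Accuracy is Chebyshev's inequality applied to the average of independent walks. Write N(p) for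
the number of ways to extend a partial mapping p. Sampling t of a candidates gives each candidate
the weight a/t times its inclusion probability t/a, so every walk is unbiased. For the second
moment, expand the square of the sampled sum. A candidate paired with itself contributes with factor
a/t ≤ 1/b. A pair of distinct candidates contributes with factor a(t-1)/(t(a-1)) ≤ 1, and there
independence leaves only means. So each sampled level costs at most a factor 1/b, and since the last
level is counted exactly, E[Y²] ≤ b^{-(n-1)} N² (`expect_walk`). The prescribed number of runs is
large enough for this (`numRuns_bound`), and N of the empty mapping is the number of embeddings
(`numExtensions_eq_card`).

For the running time, fix a fractional edge cover x and attach to p the potential W(p) = ∏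
|R_e(p)|^{x_e}, where R_e(p) consists of the matching data edges compatible with p. Three facts
carry the argument: a shortest index list has length at most W(p) (`le_potential`); the potentials
of the children of p sum to at most W(p), by a Hölder inequality (`sum_potential_update_le`); and W
≥ 1 at every node visited, because intersecting with all incident index lists never empties a
relation (`relOn_update_nonempty`). Hence each level of the recursion tree costs O(W) of the root.
The constant does not involve x, so the infimum over covers may be taken. -/

/-! ### Expectations of finitely supported laws -/

/-- The expectation of a real function under a discrete law. -/
noncomputable def PMF.expect {α : Type} (p : PMF α) (φ : α → ℝ) : ℝ := ∑' a, (p a).toReal * φ a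

namespace PMF

variable {α β : Type}

theorem expect_eq_sum {p : PMF α} {s : Finset α} (hs : p.support ⊆ s) (φ : α → ℝ) :
    p.expect φ = ∑ a ∈ s, (p a).toReal * φ a := by
  refine tsum_eq_sum fun a ha => ?_
  have : p a = 0 := by
    by_contra h
    exact ha (hs ((p.mem_support_iff a).2 h))
  simp [this]

theorem sum_toReal_eq_one {p : PMF α} {s : Finset α} (hs : p.support ⊆ s) :
    ∑ a ∈ s, (p a).toReal = 1 := by
  have h : ∑' a, p a = ∑ a ∈ s, p a := tsum_eq_sum fun a ha => by
    by_contra h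
    exact ha (hs ((p.mem_support_iff a).2 h))
  rw [p.tsum_coe] at h
  rw [← ENNReal.toReal_sum fun a _ => p.apply_ne_top a, ← h, ENNReal.toReal_one]

theorem expect_pure (a : α) (φ : α → ℝ) : (PMF.pure a).expect φ = φ a := by
  rw [expect_eq_sum (s := {a}) (by simp)]
  simp

theorem expect_bind {p : PMF α} {f : α → PMF β} (hp : p.support.Finite)
    (hf : ∀ a, (f a).support.Finite) (φ : β → ℝ) :
    (p.bind f).expect φ = p.expect fun a => (f a).expect φ := by
  classical
  set s := hp.toFinset with hs
  have hps : p.support ⊆ s := by simp [hs]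
  set t := s.biUnion fun a => (hf a).toFinset with ht
  have hft : ∀ a ∈ s, (f a).support ⊆ t := fun a ha b hb => by
    simp only [ht, Finset.coe_biUnion, Set.mem_iUnion]
    exact ⟨a, ha, by simpa using hb⟩
  have hbt : (p.bind f).support ⊆ t := by
    intro b hb
    rw [mem_support_bind_iff] at hb
    obtain ⟨a, ha, hb⟩ := hb
    exact hft a (hps ha) hb
  rw [expect_eq_sum hbt, expect_eq_sum hps]
  have h1 : ∀ b, ((p.bind f) b).toReal = ∑ a ∈ s, (p a).toReal * (f a b).toReal := fun b => by
    rw [bind_apply, tsum_eq_sum (s := s), ENNReal.toReal_sum]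
    · simp
    · exact fun a _ => ENNReal.mul_ne_top (p.apply_ne_top a) ((f a).apply_ne_top b)
    · intro a ha
      have : p a = 0 := by
        by_contra h
        exact ha (hps ((p.mem_support_iff a).2 h))
      simp [this]
  simp only [h1, Finset.sum_mul]
  rw [Finset.sum_comm]
  refine Finset.sum_congr rfl fun a ha => ?_
  rw [expect_eq_sum (hft a ha), Finset.mul_sum]
  exact Finset.sum_congr rfl fun b _ => by ring

theorem expect_map {p : PMF α} (hp : p.support.Finite) (g : α → β) (φ : β → ℝ) :
    (p.map g).expect φ = p.expect (φ ∘ g) := by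
  rw [PMF.map, expect_bind hp (fun a => by simp)]
  simp [expect_pure, Function.comp_def]

theorem expect_add {p : PMF α} (hp : p.support.Finite) (φ ψ : α → ℝ) :
    p.expect (fun a => φ a + ψ a) = p.expect φ + p.expect ψ := by
  have hs : p.support ⊆ hp.toFinset := by simp
  simp only [expect_eq_sum hs, mul_add, Finset.sum_add_distrib]

theorem expect_const_mul (p : PMF α) (c : ℝ) (φ : α → ℝ) :
    p.expect (fun a => c * φ a) = c * p.expect φ := by
  rw [expect, expect, ← tsum_mul_left]
  exact tsum_congr fun a => by ring

theorem expect_const {p : PMF α} (hp : p.support.Finite) (c : ℝ) :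
    p.expect (fun _ => c) = c := by
  have hs : p.support ⊆ hp.toFinset := by simp
  rw [expect_eq_sum hs, ← Finset.sum_mul, sum_toReal_eq_one hs, one_mul]

theorem expect_mono {p : PMF α} (hp : p.support.Finite) {φ ψ : α → ℝ} (h : ∀ a, φ a ≤ ψ a) :
    p.expect φ ≤ p.expect ψ := by
  have hs : p.support ⊆ hp.toFinset := by simp
  rw [expect_eq_sum hs, expect_eq_sum hs]
  exact Finset.sum_le_sum fun a _ => mul_le_mul_of_nonneg_left (h a) ENNReal.toReal_nonneg

theorem expect_uniformOfFintype [Fintype α] [Nonempty α] (φ : α → ℝ) :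
    (uniformOfFintype α).expect φ = (Fintype.card α : ℝ)⁻¹ * ∑ a, φ a := by
  rw [expect_eq_sum (s := Finset.univ) (by simp), Finset.mul_sum]
  simp

theorem toReal_toMeasure {p : PMF ℝ} {s : Set ℝ}
    (hs : MeasurableSet s) : (p.toMeasure s).toReal = p.expect (s.indicator 1) := by
  classical
  rw [toMeasure_apply p hs, ENNReal.tsum_toReal_eq, expect]
  · refine tsum_congr fun a => ?_
    by_cases h : a ∈ s <;> simp [h]
  · intro a
    by_cases h : a ∈ s <;> simp [h, p.apply_ne_top]

/-- Chebyshev's inequality. -/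
theorem one_sub_div_sq_le_toMeasure {p : PMF ℝ} (hp : p.support.Finite) {m d : ℝ} (hd : 0 < d)
    (hm : p.expect (fun z => z) = m) :
    1 - (p.expect (fun z => z ^ 2) - m ^ 2) / d ^ 2 ≤
      (p.toMeasure {z | |z - m| < d}).toReal := by
  rw [toReal_toMeasure (measurableSet_lt (by fun_prop) (by fun_prop))]
  -- The indicator of |z - m| < d lies above the parabola 1 - (z - m)²/d², whose expectation is the
  -- left side.
  calc _ = p.expect fun z => (1 - m ^ 2 / d ^ 2) +
        ((-1 / d ^ 2) * z ^ 2 + (2 * m / d ^ 2) * z) := by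
        rw [expect_add hp, expect_add hp, expect_const hp, expect_const_mul, expect_const_mul, hm]
        ring
    _ ≤ _ := by
        refine expect_mono hp fun z => ?_
        have e : (1 - m ^ 2 / d ^ 2) + ((-1 / d ^ 2) * z ^ 2 + (2 * m / d ^ 2) * z) =
            1 - (z - m) ^ 2 / d ^ 2 := by ring
        rw [e]
        by_cases h : |z - m| < d
        · have : 0 ≤ (z - m) ^ 2 / d ^ 2 := by positivity
          simp [h]
          linarith
        · have h' : d ≤ |z - m| := not_lt.1 h
          have : 1 ≤ (z - m) ^ 2 / d ^ 2 := by
            rw [le_div_iff₀ (by positivity), one_mul, ← sq_abs (z - m)]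
            exact pow_le_pow_left₀ hd.le h' 2
          simp [h]
          linarith

end PMF

/-! ### Expectations and worst-case step counts of randomised computations -/

namespace RandM

variable {α β : Type}

/-- The joint law of the result and the number of steps. -/
def law (x : RandM α) : PMF (α × ℕ) := x

theorem law_pure (a : α) : (pure a : RandM α).law = PMF.pure (a, 0) := rfl

theorem law_step (k : ℕ) : (step k).law = PMF.pure ((), k) := rfl

theorem law_draw (k : ℕ) :
    (draw k).law = PMF.map (fun j => (j, 1)) (PMF.uniformOfFintype (Fin (k + 1))) := rfl

theorem law_bind (x : RandM α) (f : α → RandM β) :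
    (x >>= f).law =
      PMF.bind x.law fun r => PMF.map (fun s => (s.1, r.2 + s.2)) (f r.1).law := rfl

theorem law_bind_eq_pure {x : RandM α} {f : α → RandM β} {a : α} {k : ℕ} {c : β} {l : ℕ}
    (hx : x.law = PMF.pure (a, k)) (hf : (f a).law = PMF.pure (c, l)) :
    (x >>= f).law = PMF.pure (c, k + l) := by
  rw [law_bind, hx, PMF.pure_bind, hf, PMF.pure_map]

/-- The computation has finitely many possible outcomes. -/
def FiniteRuns (x : RandM α) : Prop := x.law.support.Finite

/-- The expectation of a function of the result. -/
noncomputable def expect (x : RandM α) (φ : α → ℝ) : ℝ := x.law.expect fun r => φ r.1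

theorem finiteRuns_of_law_eq_pure {x : RandM α} {r : α × ℕ} (h : x.law = PMF.pure r) :
    x.FiniteRuns := by
  rw [FiniteRuns, h]
  simp

theorem finiteRuns_pure (a : α) : (pure a : RandM α).FiniteRuns :=
  finiteRuns_of_law_eq_pure (law_pure a)

theorem finiteRuns_step (k : ℕ) : (step k).FiniteRuns := finiteRuns_of_law_eq_pure (law_step k)

theorem finiteRuns_draw (k : ℕ) : (draw k).FiniteRuns := by
  rw [FiniteRuns, law_draw, PMF.support_map]
  exact (Set.toFinite _).image _

theorem FiniteRuns.bind {x : RandM α} {f : α → RandM β} (hx : x.FiniteRuns)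
    (hf : ∀ a, (f a).FiniteRuns) : (x >>= f).FiniteRuns := by
  rw [FiniteRuns, law_bind, PMF.support_bind]
  refine Set.Finite.biUnion hx fun r _ => ?_
  rw [PMF.support_map]
  exact Set.Finite.image _ (hf r.1)

theorem expect_pure (a : α) (φ : α → ℝ) : (pure a : RandM α).expect φ = φ a :=
  PMF.expect_pure _ _

theorem expect_of_law_eq_pure {x : RandM α} {r : α × ℕ} (h : x.law = PMF.pure r) (φ : α → ℝ) :
    x.expect φ = φ r.1 := by
  rw [expect, h, PMF.expect_pure]

theorem expect_bind {x : RandM α} {f : α → RandM β} (hx : x.FiniteRuns)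
    (hf : ∀ a, (f a).FiniteRuns) (φ : β → ℝ) :
    (x >>= f).expect φ = x.expect fun a => (f a).expect φ := by
  rw [expect, law_bind, PMF.expect_bind hx]
  · exact congrArg (PMF.expect x.law) (funext fun r => PMF.expect_map (hf r.1) _ _)
  · intro r
    rw [PMF.support_map]
    exact Set.Finite.image _ (hf r.1)

theorem expect_step_bind (k : ℕ) {f : Unit → RandM β} (hf : ∀ a, (f a).FiniteRuns) (φ : β → ℝ) :
    (step k >>= f).expect φ = (f ()).expect φ := by
  rw [expect_bind (finiteRuns_step k) hf]
  exact expect_of_law_eq_pure (law_step k) _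

theorem expect_draw (k : ℕ) (φ : Fin (k + 1) → ℝ) :
    (draw k).expect φ = ((k : ℝ) + 1)⁻¹ * ∑ j, φ j := by
  rw [expect, law_draw, PMF.expect_map (Set.toFinite _), PMF.expect_uniformOfFintype]
  simp

theorem expect_add {x : RandM α} (hx : x.FiniteRuns) (φ ψ : α → ℝ) :
    x.expect (fun a => φ a + ψ a) = x.expect φ + x.expect ψ := PMF.expect_add hx _ _

theorem expect_const_mul (x : RandM α) (c : ℝ) (φ : α → ℝ) :
    x.expect (fun a => c * φ a) = c * x.expect φ := PMF.expect_const_mul _ _ _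

theorem expect_const {x : RandM α} (hx : x.FiniteRuns) (c : ℝ) :
    x.expect (fun _ => c) = c := PMF.expect_const hx _

theorem result_eq_map_law (x : RandM α) : x.result = x.law.map Prod.fst := rfl

theorem finite_support_result {x : RandM α} (hx : x.FiniteRuns) : x.result.support.Finite := by
  rw [result_eq_map_law, PMF.support_map]
  exact Set.Finite.image _ hx

theorem expect_result {x : RandM α} (hx : x.FiniteRuns) (φ : α → ℝ) :
    x.result.expect φ = x.expect φ := PMF.expect_map hx _ _

/-- Every run takes at most `B` steps and has a result that satisfies `Q`. -/
def RunsIn (x : RandM α) (B : ℝ) (Q : α → Prop) : Prop :=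
  ∀ r ∈ x.law.support, ((r.2 : ℕ) : ℝ) ≤ B ∧ Q r.1

theorem RunsIn.mono {x : RandM α} {B B' : ℝ} {Q Q' : α → Prop} (h : x.RunsIn B Q) (hB : B ≤ B')
    (hQ : ∀ a, Q a → Q' a) : x.RunsIn B' Q' :=
  fun r hr => ⟨(h r hr).1.trans hB, hQ _ (h r hr).2⟩

theorem RunsIn.timeLE {x : RandM α} {B : ℝ} {Q : α → Prop} (h : x.RunsIn B Q) : x.TimeLE B :=
  fun r hr => (h r hr).1

theorem runsIn_of_law_eq_pure {x : RandM α} {a : α} {k : ℕ} (h : x.law = PMF.pure (a, k)) {B : ℝ}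
    {Q : α → Prop} (hB : (k : ℝ) ≤ B) (hQ : Q a) : x.RunsIn B Q := by
  intro r hr
  rw [h] at hr
  have : r = (a, k) := (PMF.mem_support_pure_iff _ _).1 hr
  subst this
  exact ⟨hB, hQ⟩

theorem runsIn_pure {a : α} {Q : α → Prop} (hQ : Q a) : (pure a : RandM α).RunsIn 0 Q :=
  runsIn_of_law_eq_pure (law_pure a) (by simp) hQ

theorem runsIn_step (k : ℕ) : (step k).RunsIn k fun _ => True :=
  runsIn_of_law_eq_pure (law_step k) le_rfl trivial

theorem runsIn_draw (k : ℕ) : (draw k).RunsIn 1 fun _ => True := by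
  intro r hr
  rw [law_draw, PMF.support_map] at hr
  obtain ⟨j, _, rfl⟩ := hr
  simp

/-- The postcondition `Q` passes information about the first result on to the cost bound of the
continuation. -/
theorem RunsIn.bind {x : RandM α} {f : α → RandM β} {B B' : ℝ} {Q : α → Prop} {Q' : β → Prop}
    (hx : x.RunsIn B Q) (hf : ∀ a, Q a → (f a).RunsIn B' Q') : (x >>= f).RunsIn (B + B') Q' := by
  intro r hr
  rw [law_bind] at hr
  obtain ⟨s, hs, hr⟩ := (PMF.mem_support_bind_iff _ _ _).1 hr
  rw [PMF.support_map] at hr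
  obtain ⟨w, hw, rfl⟩ := hr
  obtain ⟨h1, h2⟩ := hx s hs
  obtain ⟨h3, h4⟩ := hf _ h2 w hw
  refine ⟨?_, h4⟩
  push_cast
  exact add_le_add h1 h3

end RandM

namespace Alley

open LabeledGraph RandM

variable {U V Λ : Type}

/-! ### Intersecting index lists -/

theorem law_smallest (Ts : List (Finset V)) : ∀ S : Finset V, ∃ R,
    (smallest S Ts).law = PMF.pure (R, 2 * Ts.length) ∧ R ∈ S :: Ts ∧
      ∀ T ∈ S :: Ts, R.card ≤ T.card := by
  induction Ts with
  | nil => exact fun S => ⟨S, law_pure _, by simp, by simp⟩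
  | cons T Ts ih =>
    intro S
    obtain ⟨R, hR, hm, hc⟩ := ih (if T.card < S.card then T else S)
    refine ⟨R, ?_, ?_, ?_⟩
    · rw [smallest, law_bind_eq_pure (law_step 2) hR, List.length_cons]
      congr 2
      ring
    · split_ifs at hm <;> simp only [List.mem_cons] at hm ⊢ <;> tauto
    · have h := hc _ List.mem_cons_self
      simp only [List.mem_cons, forall_eq_or_imp] at hc ⊢
      split_ifs at h with hlt
      · exact ⟨by omega, h, hc.2⟩
      · exact ⟨h, by omega, hc.2⟩

open Classical in
theorem law_memAll (v : V) (Ts : List (Finset V)) :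
    ∃ k ≤ Ts.length, (memAll v Ts).law = PMF.pure (decide (∀ T ∈ Ts, v ∈ T), k) := by
  induction Ts with
  | nil => exact ⟨0, le_rfl, by rw [memAll, law_pure]; simp⟩
  | cons T Ts ih =>
    obtain ⟨k, hk, h⟩ := ih
    by_cases hv : v ∈ T
    · refine ⟨1 + k, by simp; omega, ?_⟩
      rw [memAll, law_bind_eq_pure (law_step 1) (by rw [if_pos hv]; exact h)]
      simp [hv]
    · refine ⟨1 + 0, by simp, ?_⟩
      rw [memAll, law_bind_eq_pure (law_step 1) (by rw [if_neg hv]; exact law_pure false)]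
      simp [hv]

-- Per entry: one step to read it, at most one per membership test, and one to write it if kept.
open Classical in
theorem law_filterBy (Ts : List (Finset V)) (vs : List V) :
    ∃ k ≤ vs.length * (Ts.length + 2),
      (filterBy Ts vs).law = PMF.pure (vs.filter fun v => ∀ T ∈ Ts, v ∈ T, k) := by
  induction vs with
  | nil => exact ⟨0, by simp, law_pure _⟩
  | cons v vs ih =>
    obtain ⟨k, hk, h⟩ := ih
    obtain ⟨l, hl, h'⟩ := law_memAll v Ts
    by_cases hv : ∀ T ∈ Ts, v ∈ T
    · refine ⟨1 + (l + (k + (1 + 0))), ?_, ?_⟩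
      · rw [List.length_cons, add_mul]
        omega
      · rw [filterBy, List.filter_cons_of_pos (by simpa using hv)]
        refine law_bind_eq_pure (law_step 1) (law_bind_eq_pure h' (law_bind_eq_pure h ?_))
        rw [if_pos (by simpa using hv)]
        exact law_bind_eq_pure (law_step 1) (law_pure _)
    · refine ⟨1 + (l + (k + 0)), ?_, ?_⟩
      · rw [List.length_cons, add_mul]
        omega
      · rw [filterBy, List.filter_cons_of_neg (by simpa using hv)]
        refine law_bind_eq_pure (law_step 1) (law_bind_eq_pure h' (law_bind_eq_pure h ?_))
        rw [if_neg (by simpa using hv)]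
        exact law_pure _

/-- The intersection of index lists is computed deterministically, in time linear in the length of
a shortest list. -/
theorem law_intersect (L : List (Finset V)) : ∃ r k,
    (intersect L).law = PMF.pure (r, k) ∧ r.Nodup ∧ (L ≠ [] → ∀ v, v ∈ r ↔ ∀ T ∈ L, v ∈ T) ∧
      ∃ m : ℕ, (∀ T ∈ L, m ≤ T.card) ∧ k ≤ 2 * L.length + m * (L.length + 2) := by
  classical
  cases L with
  | nil => exact ⟨[], 0, law_pure _, by simp, by simp, 0, by simp, by simp⟩
  | cons T Ts =>
    obtain ⟨R, hR, hm, hc⟩ := law_smallest Ts T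
    obtain ⟨k, hk, h⟩ := law_filterBy (T :: Ts) R.toList
    refine ⟨_, _, law_bind_eq_pure (law_step 2) (law_bind_eq_pure hR h),
      (Finset.nodup_toList R).filter _, ?_, R.card, hc, ?_⟩
    · intro _ v
      simp only [List.mem_filter, Finset.mem_toList, decide_eq_true_eq, and_iff_right_iff_imp]
      exact fun h => h R hm
    · rw [Finset.length_toList] at hk
      simp only [List.length_cons] at hk ⊢
      omega

/-! ### Sampling without replacement -/

/-- The moments and cost bounds of sampling depend on the array only up to order, so this is all
that is needed about the in-place removal. -/
theorem cons_swapRemove_perm (A : List V) (j : ℕ) (hj : j < A.length) :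
    (A[j] :: swapRemove A j).Perm A := by
  classical
  -- With the last entry z split off, either j lies in B and is overwritten by z, or j is the
  -- position of z itself.
  obtain ⟨B, z, rfl⟩ : ∃ B z, A = B ++ [z] :=
    ⟨A.dropLast, A.getLast (by rintro rfl; simp at hj), (List.dropLast_append_getLast _).symm⟩
  rw [swapRemove]
  simp only [List.getLast?_append, List.getLast?_singleton, Option.some_or]
  rcases lt_or_ge j B.length with h | h
  · rw [List.set_append_left _ _ h, List.dropLast_concat, List.getElem_append_left h,
      List.set_eq_take_append_cons_drop, if_pos h]
    conv_rhs => rw [← List.take_append_drop j B, List.drop_eq_getElem_cons h]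
    rw [List.perm_iff_count]
    intro a
    simp only [List.count_cons, List.count_append, List.count_nil]
    omega
  · have : j = B.length := by simp at hj; omega
    subst this
    simp [List.set_append_right]
    exact (List.perm_append_singleton z B).symm

theorem finiteRuns_sample (t : ℕ) : ∀ A : List V, (sample t A).FiniteRuns := by
  induction t with
  | zero => exact fun A => finiteRuns_pure _
  | succ t ih =>
    intro A
    cases A with
    | nil => exact finiteRuns_pure _
    | cons a A =>
      exact (finiteRuns_draw _).bind fun j => (finiteRuns_step _).bind fun _ =>
        (ih _).bind fun _ => finiteRuns_pure _

theorem expect_sample_succ (t : ℕ) (a : V) (A : List V) (φ : List V → ℝ) :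
    (sample (t + 1) (a :: A)).expect φ = ((A.length : ℝ) + 1)⁻¹ *
      ∑ j : Fin (A.length + 1), (sample t (swapRemove (a :: A) j)).expect
        fun S => φ ((a :: A).get j :: S) := by
  rw [sample, expect_bind (finiteRuns_draw _), expect_draw]
  · congr 1
    refine Finset.sum_congr rfl fun j _ => ?_
    rw [expect_step_bind, expect_bind (finiteRuns_sample _ _)]
    · simp only [expect_pure]
    · exact fun _ => finiteRuns_pure _
    · exact fun _ => (finiteRuns_sample _ _).bind fun _ => finiteRuns_pure _
  · exact fun j => (finiteRuns_step _).bind fun _ =>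
        (finiteRuns_sample _ _).bind fun _ => finiteRuns_pure _

/-- The sub-permutation later allows a nonnegative cost summed over the sample to be bounded by its
sum over all candidates. -/
theorem runsIn_sample (t : ℕ) : ∀ A : List V,
    (sample t A).RunsIn (5 * t) fun S => S.Subperm A := by
  induction t with
  | zero => exact fun A => (runsIn_pure (Q := fun S : List V => S.Subperm A) List.nil_subperm).mono (by simp) fun _ h => h
  | succ t ih =>
    intro A
    cases A with
    | nil =>
      exact (runsIn_pure (Q := fun S : List V => S.Subperm []) List.nil_subperm).mono
        (by positivity) fun _ h => h
    | cons a A =>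
      rw [sample]
      refine ((runsIn_draw _).bind fun j _ => (runsIn_step 4).bind fun _ _ =>
        (ih (swapRemove (a :: A) j)).bind fun S hS => runsIn_pure ?_).mono
          (B := 1 + ((4 : ℕ) + (5 * t + 0))) ?_ fun _ h => h
      · have := cons_swapRemove_perm (a :: A) j j.2
        exact ((List.subperm_cons _).2 hS).trans this.subperm
      · push_cast
        linarith

theorem sum_map_swapRemove (A : List V) (j : Fin A.length) (φ : V → ℝ) :
    ((swapRemove A j).map φ).sum = (A.map φ).sum - φ (A.get j) := by
  have := ((cons_swapRemove_perm A j j.2).map φ).sum_eq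
  rw [List.map_cons, List.sum_cons] at this
  rw [← this, List.get_eq_getElem]
  ring

theorem length_swapRemove_cons (a : V) (A : List V) (j : Fin (A.length + 1)) :
    (swapRemove (a :: A) j).length = A.length := by
  have := (cons_swapRemove_perm (a :: A) j j.2).length_eq
  simpa using this

theorem sum_get (A : List V) (φ : V → ℝ) : ∑ j : Fin A.length, φ (A.get j) = (A.map φ).sum := by
  rw [← List.sum_ofFn]
  congr 1
  conv_rhs => rw [← List.ofFn_get A, List.map_ofFn]
  rfl

/-- Each position is selected with probability t/|A|. The induction conditions on the first draw v,
which gives φ(v) plus the formula for the remaining array, and then averages over v. -/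
theorem expect_sample_sum (φ : V → ℝ) (t : ℕ) : ∀ A : List V, t ≤ A.length →
    (sample t A).expect (fun S => (S.map φ).sum) = t / A.length * (A.map φ).sum := by
  induction t with
  | zero =>
    intro A _
    rw [sample, expect_pure]
    simp
  | succ t ih =>
    intro A h
    cases A with
    | nil => simp at h
    | cons a A =>
      have h' : t ≤ A.length := by simpa using h
      rw [expect_sample_succ]
      simp only [List.map_cons, List.sum_cons]
      have e : ∀ j : Fin (A.length + 1),
          ((sample t (swapRemove (a :: A) j)).expect fun S => φ ((a :: A).get j) + (S.map φ).sum) =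
            φ ((a :: A).get j) + t / A.length * (((a :: A).map φ).sum - φ ((a :: A).get j)) := by
        intro j
        rw [expect_add (finiteRuns_sample _ _), expect_const (finiteRuns_sample _ _),
          ih _ (by rwa [length_swapRemove_cons]), length_swapRemove_cons,
          sum_map_swapRemove (a :: A) j φ]
      rw [Finset.sum_congr rfl fun j _ => e j, Finset.sum_add_distrib, ← Finset.mul_sum,
        Finset.sum_sub_distrib]
      have e2 := sum_get (a :: A) φ
      simp only [List.length_cons] at e2
      rw [e2]
      simp only [Finset.sum_const, Finset.card_univ, Fintype.card_fin, List.map_cons,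
        List.sum_cons, nsmul_eq_mul, List.length_cons]
      push_cast
      -- For an empty tail the quotient t/|A| is the default 0, which is right because t = 0.
      rcases Nat.eq_zero_or_pos A.length with h0 | h0
      · have ht : t = 0 := by omega
        have : A = [] := List.length_eq_zero_iff.1 h0
        subst this
        simp [ht]
      · have : (A.length : ℝ) ≠ 0 := by positivity
        field_simp
        ring

/-- The sum of the products of pairs of values at different positions. -/
noncomputable def offDiagSum (m : V → ℝ) (A : List V) : ℝ :=
  (A.map m).sum ^ 2 - (A.map fun v => m v ^ 2).sum

theorem offDiagSum_nil (m : V → ℝ) : offDiagSum m [] = 0 := by simp [offDiagSum]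

theorem offDiagSum_cons (m : V → ℝ) (v : V) (A : List V) :
    offDiagSum m (v :: A) = 2 * m v * (A.map m).sum + offDiagSum m A := by
  simp [offDiagSum]
  ring

theorem offDiagSum_nonneg {m : V → ℝ} (hm : ∀ v, 0 ≤ m v) (A : List V) : 0 ≤ offDiagSum m A := by
  induction A with
  | nil => rw [offDiagSum_nil]
  | cons v A ih =>
    rw [offDiagSum_cons]
    have : 0 ≤ (A.map m).sum := List.sum_nonneg (by simpa using fun a _ => hm a)
    have := hm v
    positivity

theorem offDiagSum_swapRemove (m : V → ℝ) (A : List V) (j : Fin A.length) :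
    offDiagSum m (swapRemove A j) =
      offDiagSum m A - 2 * m (A.get j) * ((A.map m).sum - m (A.get j)) := by
  rw [offDiagSum, sum_map_swapRemove, sum_map_swapRemove A j fun v => m v ^ 2, offDiagSum]
  ring

theorem sum_map_mul_sub (m : V → ℝ) (M : ℝ) (A : List V) :
    (A.map fun v => 2 * m v * (M - m v)).sum =
      2 * M * (A.map m).sum - 2 * (A.map fun v => m v ^ 2).sum := by
  induction A with
  | nil => simp
  | cons v A ih =>
    simp only [List.map_cons, List.sum_cons, ih]
    ring

/-- An ordered pair of distinct positions is selected with probability t(t-1)/(a(a-1)), where a =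
|A|. -/
theorem expect_sample_offDiagSum (m : V → ℝ) (t : ℕ) : ∀ A : List V, t ≤ A.length →
    (sample t A).expect (offDiagSum m) =
      t * (t - 1) / (A.length * (A.length - 1)) * offDiagSum m A := by
  induction t with
  | zero =>
    intro A _
    rw [sample, expect_pure]
    simp [offDiagSum]
  | succ t ih =>
    intro A h
    cases A with
    | nil => simp at h
    | cons a A =>
      have h' : t ≤ A.length := by simpa using h
      rw [expect_sample_succ]
      simp only [offDiagSum_cons m _ _]
      have e : ∀ j : Fin (A.length + 1),
          ((sample t (swapRemove (a :: A) j)).expect fun S =>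
            2 * m ((a :: A).get j) * (S.map m).sum + offDiagSum m S) =
            t / A.length * (2 * m ((a :: A).get j) * (((a :: A).map m).sum - m ((a :: A).get j))) +
            t * (t - 1) / (A.length * (A.length - 1)) * (offDiagSum m (a :: A) -
              2 * m ((a :: A).get j) * (((a :: A).map m).sum - m ((a :: A).get j))) := by
        intro j
        rw [expect_add (finiteRuns_sample _ _), expect_const_mul,
          ih _ (by rwa [length_swapRemove_cons]), length_swapRemove_cons,
          expect_sample_sum m _ _ (by rwa [length_swapRemove_cons]), length_swapRemove_cons,
          sum_map_swapRemove (a :: A) j m, offDiagSum_swapRemove m (a :: A) j]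
        ring
      have e2 := sum_get (a :: A) fun v => 2 * m v * (((a :: A).map m).sum - m v)
      -- With M the total, 2 m_j (M - m_j) collects the ordered pairs that meet position j, and each
      -- pair meets two positions.
      have e3 : ((a :: A).map fun v => 2 * m v * (((a :: A).map m).sum - m v)).sum =
          2 * offDiagSum m (a :: A) := by
        rw [sum_map_mul_sub, offDiagSum]
        ring
      rw [e3] at e2
      simp only [List.length_cons] at e2
      rw [Finset.sum_congr rfl fun j _ => e j, Finset.sum_add_distrib, ← Finset.mul_sum,
        ← Finset.mul_sum, Finset.sum_sub_distrib, e2]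
      simp only [Finset.sum_const, Finset.card_univ, Fintype.card_fin,
        nsmul_eq_mul, List.length_cons, ← offDiagSum_cons]
      push_cast
      simp only [add_sub_cancel_right]
      clear e e2
      -- Tails of length 0 and 1 make the denominator vanish and are checked by hand.
      rcases Nat.lt_or_ge A.length 2 with h0 | h0
      · rcases Nat.lt_or_ge A.length 1 with h1 | h1
        · have : A = [] := List.length_eq_zero_iff.1 (by omega)
          subst this
          simp [offDiagSum]
        · have hA : A.length = 1 := by omega
          rw [hA] at h' ⊢
          interval_cases t <;> norm_num
          ring
      · have : (2 : ℝ) ≤ A.length := by exact_mod_cast h0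
        have : (A.length : ℝ) ≠ 0 := by positivity
        have : (A.length : ℝ) - 1 ≠ 0 := by linarith
        field_simp
        ring

end Alley

namespace Alley

open LabeledGraph RandM

variable {U V Λ : Type}

/-! ### Moments of the random walk -/

theorem finiteRuns_sumOver {f : V → RandM ℝ} (hf : ∀ v, (f v).FiniteRuns) (S : List V) :
    (sumOver f S).FiniteRuns := by
  induction S with
  | nil => exact finiteRuns_pure _
  | cons v S ih =>
    exact (finiteRuns_step _).bind fun _ => (hf v).bind fun _ => ih.bind fun _ =>
      (finiteRuns_step _).bind fun _ => finiteRuns_pure _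

theorem expect_sumOver_cons {f : V → RandM ℝ} (hf : ∀ v, (f v).FiniteRuns) (v : V) (S : List V)
    (φ : ℝ → ℝ) : (sumOver f (v :: S)).expect φ =
      (f v).expect fun w => (sumOver f S).expect fun s => φ (w + s) := by
  have h1 : ∀ w s : ℝ, ((step 1 : RandM Unit) >>= fun _ => pure (w + s)).FiniteRuns :=
    fun w s => (finiteRuns_step _).bind fun _ => finiteRuns_pure _
  rw [sumOver, expect_step_bind _ fun _ => (hf v).bind fun w =>
    (finiteRuns_sumOver hf S).bind fun s => h1 w s,
    expect_bind (hf v) fun w => (finiteRuns_sumOver hf S).bind fun s => h1 w s]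
  refine congrArg _ (funext fun w => ?_)
  rw [expect_bind (finiteRuns_sumOver hf S) fun s => h1 w s]
  refine congrArg _ (funext fun s => ?_)
  rw [expect_step_bind _ fun _ => finiteRuns_pure _, expect_pure]

theorem expect_const_mul_self (x : RandM ℝ) (c : ℝ) :
    x.expect (fun y => c * y) = c * x.expect fun y => y := expect_const_mul _ _ _

theorem expect_sumOver {f : V → RandM ℝ} (hf : ∀ v, (f v).FiniteRuns) (S : List V) :
    (sumOver f S).expect (fun y => y) = (S.map fun v => (f v).expect fun y => y).sum := by
  induction S with
  | nil =>
    rw [sumOver, expect_pure]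
    simp
  | cons v S ih =>
    rw [expect_sumOver_cons hf]
    simp only [expect_add (finiteRuns_sumOver hf S), expect_const (finiteRuns_sumOver hf S),
      expect_add (hf v), expect_const (hf v), ih, List.map_cons, List.sum_cons]

theorem expect_add_sq {x y : RandM ℝ} (hx : x.FiniteRuns) (hy : y.FiniteRuns) :
    (x.expect fun w => y.expect fun s => (w + s) ^ 2) = (x.expect fun w => w ^ 2) +
      2 * (x.expect fun w => w) * (y.expect fun s => s) + y.expect fun s => s ^ 2 := by
  have e : ∀ w s : ℝ, (w + s) ^ 2 = w ^ 2 + (2 * w * s + s ^ 2) := fun w s => by ring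
  simp only [e, expect_add hy, expect_const hy, expect_const_mul_self]
  have e2 : ∀ w : ℝ, 2 * w * (y.expect fun s => s) = (2 * y.expect fun s => s) * w :=
    fun w => by ring
  simp only [e2, expect_add hx, expect_const hx, expect_const_mul_self]
  ring

/-- The recursive runs are independent, so cross terms factor into means and only the diagonal terms
involve second moments. -/
theorem expect_sumOver_sq {f : V → RandM ℝ} (hf : ∀ v, (f v).FiniteRuns) (S : List V) :
    (sumOver f S).expect (fun y => y ^ 2) = (S.map fun v => (f v).expect fun y => y ^ 2).sum +
      offDiagSum (fun v => (f v).expect fun y => y) S := by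
  induction S with
  | nil =>
    rw [offDiagSum_nil, sumOver, expect_pure]
    simp
  | cons v S ih =>
    rw [expect_sumOver_cons hf, expect_add_sq (hf v) (finiteRuns_sumOver hf S), ih,
      expect_sumOver hf, offDiagSum_cons, List.map_cons, List.sum_cons]
    ring

theorem finiteRuns_intersect (L : List (Finset V)) : (intersect L).FiniteRuns := by
  obtain ⟨r, k, h, _⟩ := law_intersect L
  exact finiteRuns_of_law_eq_pure h

section Walk

variable [Fintype V] (q : LabeledGraph U Λ) (g : LabeledGraph V Λ)

open Classical in
/-- The intersection of the index lists for `u`. -/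
noncomputable def candidates (p : U → Option V) (u : U) : Finset V :=
  Finset.univ.filter fun v => ∀ T ∈ indexLists q g p u, v ∈ T

open Classical in
/-- The number of ways to map the listed vertices one after the other to candidates. -/
noncomputable def numExtensions : List U → (U → Option V) → ℕ
  | [], _ => 1
  | u :: us, p => ∑ v ∈ candidates q g p u, numExtensions us (Function.update p u (some v))

variable {q g}

theorem mem_candidates {p : U → Option V} {u : U} {v : V} :
    v ∈ candidates q g p u ↔ ∀ e ∈ q.edges, Incident e u → v ∈ indexList q g p u e := by
  classical
  have h : v ∈ candidates q g p u ↔ ∀ T ∈ indexLists q g p u, v ∈ T := by simp [candidates]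
  rw [h]
  simp only [indexLists, Finset.mem_filter, List.mem_map, Finset.mem_toList]
  exact ⟨fun h e he hu => h _ ⟨e, ⟨he, hu⟩, rfl⟩, by rintro h T ⟨e, ⟨he, hu⟩, rfl⟩; exact h e he hu⟩

theorem indexLists_ne_nil (hq : ∀ u, ∃ e ∈ q.edges, Incident e u) (p : U → Option V) (u : U) :
    indexLists q g p u ≠ [] := by
  classical
  obtain ⟨e, he, hu⟩ := hq u
  simp only [indexLists, ne_eq, List.map_eq_nil_iff, Finset.toList_eq_nil]
  exact Finset.ne_empty_of_mem (Finset.mem_filter.2 ⟨he, hu⟩)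

theorem law_intersect_indexLists (hq : ∀ u, ∃ e ∈ q.edges, Incident e u) (p : U → Option V)
    (u : U) : ∃ r k, (intersect (indexLists q g p u)).law = PMF.pure (r, k) ∧
      r.Nodup ∧ r.length = (candidates q g p u).card ∧
      (∀ φ : V → ℝ, (r.map φ).sum = ∑ v ∈ candidates q g p u, φ v) ∧
      (∀ v, v ∈ r ↔ v ∈ candidates q g p u) ∧
      ∃ m : ℕ, (∀ e ∈ q.edges, Incident e u → m ≤ (indexList q g p u e).card) ∧
        k ≤ 2 * (indexLists q g p u).length + m * ((indexLists q g p u).length + 2) := by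
  classical
  obtain ⟨r, k, h, hn, hm, m, hc, hk⟩ := law_intersect (indexLists q g p u)
  have hr : r.toFinset = candidates q g p u := by
    ext v
    rw [List.mem_toFinset, hm (indexLists_ne_nil hq p u)]
    simp [candidates]
  refine ⟨r, k, h, hn, ?_, fun φ => ?_, fun v => by rw [← hr, List.mem_toFinset], m,
    fun e he hu => hc _ ?_, hk⟩
  · rw [← hr, List.toFinset_card_of_nodup hn]
  · rw [← hr, List.sum_toFinset _ hn]
  · rw [indexLists, List.mem_map]
    exact ⟨e, by simp [he, hu], rfl⟩

variable (q g) in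
theorem finiteRuns_walk (b : ℝ) (us : List U) :
    ∀ p : U → Option V, (walk q g b us p).FiniteRuns := by
  induction us with
  | nil => exact fun p => finiteRuns_pure _
  | cons u us ih =>
    intro p
    cases us with
    | nil => exact (finiteRuns_intersect _).bind fun _ => (finiteRuns_step _).bind fun _ =>
        finiteRuns_pure _
    | cons u' us =>
      exact (finiteRuns_intersect _).bind fun _ => (finiteRuns_step _).bind fun _ =>
        (finiteRuns_sample _ _).bind fun _ => (finiteRuns_sumOver (fun v => ih _) _).bind fun _ =>
        (finiteRuns_step _).bind fun _ => finiteRuns_pure _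

open Classical in
theorem expect_walk_cons_cons (b : ℝ) (u u' : U) (us : List U) (p : U → Option V) {r : List V}
    {k : ℕ} (h : (intersect (indexLists q g p u)).law = PMF.pure (r, k)) (φ : ℝ → ℝ) :
    (walk q g b (u :: u' :: us) p).expect φ =
      (sample ⌈b * (r.length : ℝ)⌉₊ r).expect fun S =>
        (sumOver (fun v => walk q g b (u' :: us) (Function.update p u (some v))) S).expect
          fun s => φ ((r.length : ℝ) * (1 / (⌈b * (r.length : ℝ)⌉₊ : ℝ)) * s) := by
  have h3 : ∀ y : ℝ, ((step 2 : RandM Unit) >>= fun _ => pure y).FiniteRuns :=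
    fun y => (finiteRuns_step _).bind fun _ => finiteRuns_pure _
  have h2 := fun S : List V => finiteRuns_sumOver
    (f := fun v => walk q g b (u' :: us) (Function.update p u (some v)))
    (fun v => finiteRuns_walk q g b _ _) S
  rw [walk, expect_bind (finiteRuns_intersect _), expect_of_law_eq_pure h, expect_step_bind,
    expect_bind (finiteRuns_sample _ _)]
  · refine congrArg _ (funext fun S => ?_)
    rw [expect_bind (h2 S) fun s => h3 _]
    refine congrArg _ (funext fun s => ?_)
    rw [expect_step_bind _ fun _ => finiteRuns_pure _, expect_pure]
  · exact fun S => (h2 S).bind fun s => h3 _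
  · exact fun _ => (finiteRuns_sample _ _).bind fun S => (h2 S).bind fun s => h3 _
  · exact fun _ => (finiteRuns_step _).bind fun _ =>
      (finiteRuns_sample _ _).bind fun S => (h2 S).bind fun s => h3 _

theorem expect_walk_singleton (b : ℝ) (u : U) (p : U → Option V) {r : List V}
    {k : ℕ} (h : (intersect (indexLists q g p u)).law = PMF.pure (r, k)) (φ : ℝ → ℝ) :
    (walk q g b [u] p).expect φ = φ r.length := by
  rw [walk, expect_bind (finiteRuns_intersect _), expect_of_law_eq_pure h, expect_step_bind,
    expect_pure]
  · exact fun _ => finiteRuns_pure _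
  · exact fun _ => (finiteRuns_step _).bind fun _ => finiteRuns_pure _

/-- One level of the variance recursion: `Q` and `H` are the diagonal and off-diagonal parts of the
squared count, and `s2` is the sum of the children's second moments. The diagonal is scaled by a/t ≤
1/b. The off-diagonal part is scaled by at most 1, since t ≤ a. -/
theorem second_moment_bound {a t b K s2 Q H : ℝ} (ht : 1 ≤ t) (hta : t ≤ a) (hb0 : 0 < b)
    (hb1 : b < 1) (hbt : b * a ≤ t) (hK : 1 ≤ K) (hQ : 0 ≤ Q) (hH : 0 ≤ H) (hs : s2 ≤ K * Q) :
    (a * (1 / t)) ^ 2 * (t / a * s2 + t * (t - 1) / (a * (a - 1)) * H) ≤ 1 / b * K * (Q + H) := by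
  have ht0 : 0 < t := by linarith
  have ha0 : 0 < a := by linarith
  have h1 : (a * (1 / t)) ^ 2 * (t / a * s2) ≤ 1 / b * K * Q := by
    have e : (a * (1 / t)) ^ 2 * (t / a * s2) = a / t * s2 := by field_simp
    have h : a / t ≤ 1 / b := by
      rw [div_le_div_iff₀ ht0 hb0]
      linarith
    rw [e, mul_assoc]
    calc a / t * s2 ≤ a / t * (K * Q) := by gcongr
      _ ≤ 1 / b * (K * Q) := by gcongr
  have h2 : (a * (1 / t)) ^ 2 * (t * (t - 1) / (a * (a - 1)) * H) ≤ H := by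
    -- For a = 1 the denominator is 0, so the left side is 0 by convention.
    rcases eq_or_lt_of_le (ht.trans hta) with rfl | ha1
    · simpa using hH
    · have ha1' : 0 < a - 1 := by linarith
      have e : (a * (1 / t)) ^ 2 * (t * (t - 1) / (a * (a - 1)) * H) =
          (a * (t - 1)) / (t * (a - 1)) * H := by field_simp
      rw [e]
      refine mul_le_of_le_one_left hH ?_
      rw [div_le_one (by positivity)]
      linarith
  have h3 : 1 ≤ 1 / b * K := by
    have : 1 ≤ 1 / b := by
      rw [le_div_iff₀ hb0]
      linarith
    nlinarith
  nlinarith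

/-- Only `us.length - 1` levels are sampled, as the last one returns its exact count. Truncated
subtraction also covers the empty list. -/
theorem expect_walk {b : ℝ} (hb0 : 0 < b) (hb1 : b < 1)
    (hq : ∀ u, ∃ e ∈ q.edges, Incident e u) (us : List U) : ∀ p : U → Option V,
    (walk q g b us p).expect (fun y => y) = numExtensions q g us p ∧
    (walk q g b us p).expect (fun y => y ^ 2) ≤
      (1 / b) ^ (us.length - 1) * (numExtensions q g us p : ℝ) ^ 2 := by
  classical
  induction us with
  | nil =>
    intro p
    rw [walk, expect_pure, expect_pure]
    simp [numExtensions]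
  | cons u us ih =>
    intro p
    obtain ⟨r, k, h, hn, hl, hs, -⟩ := law_intersect_indexLists (g := g) hq p u
    cases us with
    | nil =>
      rw [expect_walk_singleton b u p h, expect_walk_singleton b u p h]
      simp [numExtensions, hl]
    | cons u' us =>
      have hf : ∀ v, (walk q g b (u' :: us) (Function.update p u (some v))).FiniteRuns :=
        fun v => finiteRuns_walk q g b _ _
      have hN : (numExtensions q g (u :: u' :: us) p : ℝ) =
          (r.map fun v => (numExtensions q g (u' :: us) (Function.update p u (some v)) : ℝ)).sum := by
        rw [hs, numExtensions]
        push_cast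
        rfl
      rw [expect_walk_cons_cons b u u' us p h, expect_walk_cons_cons b u u' us p h]
      simp only [mul_pow, expect_const_mul, expect_const_mul_self]
      simp only [expect_sumOver_sq hf, expect_sumOver hf]
      simp only [(ih _).1]
      rw [hN]
      set m : V → ℝ := fun v => numExtensions q g (u' :: us) (Function.update p u (some v)) with hm
      have hm0 : ∀ v, 0 ≤ m v := fun v => Nat.cast_nonneg _
      -- Without candidates t = 0, and both the walk and the count are 0.
      rcases Nat.eq_zero_or_pos r.length with h0 | h0
      · have : r = [] := List.length_eq_zero_iff.1 h0
        subst this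
        simp [offDiagSum_nil, sample, expect_pure]
      set t := ⌈b * (r.length : ℝ)⌉₊ with ht
      have hr0 : (0 : ℝ) < r.length := by exact_mod_cast h0
      have htr : t ≤ r.length := Nat.ceil_le.2 (by nlinarith)
      have ht0 : 0 < t := Nat.ceil_pos.2 (by positivity)
      have ht0' : (0 : ℝ) < t := by exact_mod_cast ht0
      rw [expect_add (finiteRuns_sample _ _), expect_sample_sum _ _ _ htr,
        expect_sample_sum _ _ _ htr, expect_sample_offDiagSum _ _ _ htr]
      refine ⟨by field_simp, ?_⟩
      have hQH : (r.map m).sum ^ 2 = (r.map fun v => m v ^ 2).sum + offDiagSum m r := by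
        rw [offDiagSum]
        ring
      have hlen : (u :: u' :: us).length - 1 = (u' :: us).length - 1 + 1 := by simp
      rw [hQH, hlen, pow_succ' (1 / b), ← mul_pow]
      refine second_moment_bound (by exact_mod_cast ht0) (by exact_mod_cast htr) hb0 hb1
        (Nat.le_ceil _) ?_ ?_ (offDiagSum_nonneg hm0 r) ?_
      · exact one_le_pow₀ (by rw [le_div_iff₀ hb0]; linarith)
      · exact List.sum_nonneg (by simpa using fun v _ => sq_nonneg (m v))
      · rw [← List.sum_map_mul_left]
        exact List.sum_le_sum fun v _ => (ih _).2

end Walk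

/-! ### Averaging independent runs -/

theorem finiteRuns_sumRuns {x : RandM ℝ} (hx : x.FiniteRuns) (h : ℕ) :
    (sumRuns x h).FiniteRuns := by
  induction h with
  | zero => exact finiteRuns_pure _
  | succ h ih =>
    exact (finiteRuns_step _).bind fun _ => hx.bind fun _ => ih.bind fun _ =>
      (finiteRuns_step _).bind fun _ => finiteRuns_pure _

theorem expect_sumRuns_succ {x : RandM ℝ} (hx : x.FiniteRuns) (h : ℕ) (φ : ℝ → ℝ) :
    (sumRuns x (h + 1)).expect φ =
      x.expect fun w => (sumRuns x h).expect fun s => φ (w + s) := by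
  have h1 : ∀ w s : ℝ, ((step 1 : RandM Unit) >>= fun _ => pure (w + s)).FiniteRuns :=
    fun w s => (finiteRuns_step _).bind fun _ => finiteRuns_pure _
  rw [sumRuns, expect_step_bind _ fun _ => hx.bind fun w =>
    (finiteRuns_sumRuns hx h).bind fun s => h1 w s,
    expect_bind hx fun w => (finiteRuns_sumRuns hx h).bind fun s => h1 w s]
  refine congrArg _ (funext fun w => ?_)
  rw [expect_bind (finiteRuns_sumRuns hx h) fun s => h1 w s]
  refine congrArg _ (funext fun s => ?_)
  rw [expect_step_bind _ fun _ => finiteRuns_pure _, expect_pure]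

theorem expect_sumRuns {x : RandM ℝ} (hx : x.FiniteRuns) (h : ℕ) :
    (sumRuns x h).expect (fun y => y) = h * x.expect fun y => y := by
  induction h with
  | zero => rw [sumRuns, expect_pure]; simp
  | succ h ih =>
    rw [expect_sumRuns_succ hx]
    simp only [expect_add (finiteRuns_sumRuns hx h), expect_const (finiteRuns_sumRuns hx h),
      expect_add hx, expect_const hx, ih]
    push_cast
    ring

theorem expect_sumRuns_sq {x : RandM ℝ} (hx : x.FiniteRuns) (h : ℕ) :
    (sumRuns x h).expect (fun y => y ^ 2) =
      h * (x.expect fun y => y ^ 2) + h * (h - 1) * (x.expect fun y => y) ^ 2 := by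
  induction h with
  | zero => rw [sumRuns, expect_pure]; simp
  | succ h ih =>
    rw [expect_sumRuns_succ hx, expect_add_sq hx (finiteRuns_sumRuns hx h), ih, expect_sumRuns hx]
    push_cast
    ring

section Estimate

variable [Fintype V] {q : LabeledGraph U Λ} {g : LabeledGraph V Λ}

variable (q g) in
theorem finiteRuns_estimate (b : ℝ) (o : List U) (h : ℕ) : (estimate q g b o h).FiniteRuns :=
  (finiteRuns_sumRuns (finiteRuns_walk q g b _ _) _).bind fun _ => (finiteRuns_step _).bind fun _ =>
    finiteRuns_pure _

variable (q g) in
theorem expect_estimate (b : ℝ) (o : List U) (h : ℕ) (φ : ℝ → ℝ) :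
    (estimate q g b o h).expect φ =
      (sumRuns (walk q g b o fun _ => none) h).expect fun s => φ (s / h) := by
  rw [estimate, expect_bind (finiteRuns_sumRuns (finiteRuns_walk q g b _ _) _) fun _ =>
    (finiteRuns_step _).bind fun _ => finiteRuns_pure _]
  refine congrArg _ (funext fun s => ?_)
  rw [expect_step_bind _ fun _ => finiteRuns_pure _, expect_pure]

/-- The numerator b/(1-b)·(b^{-n} - 1) is the geometric sum 1 + b^{-1} + ⋯ + b^{-(n-1)}; its last
term alone is needed. -/
theorem numRuns_bound {b : ℝ} (hb0 : 0 < b) (hb1 : b < 1) {n : ℕ} (hn : 0 < n) {ε μ : ℝ}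
    (hε : 0 < ε) (hμ1 : μ < 1) :
    (1 / b) ^ (n - 1) ≤ numRuns b n ε μ * (ε ^ 2 * (1 - μ)) := by
  obtain ⟨k, rfl⟩ : ∃ k, n = k + 1 := ⟨n - 1, by omega⟩
  have h1 : 0 < ε ^ 2 * (1 - μ) := mul_pos (by positivity) (by linarith)
  have h2 : 0 < 1 - b := by linarith
  rw [← div_le_iff₀ h1]
  refine le_trans ?_ (Nat.le_ceil _)
  gcongr
  rw [Nat.add_sub_cancel, one_div_pow]
  have e : b / (1 - b) * (1 / b ^ (k + 1) - 1) = (1 - b ^ (k + 1)) / ((1 - b) * b ^ k) := by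
    field_simp
    ring
  rw [e, div_le_div_iff₀ (by positivity) (by positivity)]
  have : b ^ (k + 1) ≤ b := by
    rw [pow_succ]
    exact mul_le_of_le_one_left hb0.le (pow_le_one₀ hb0.le hb1.le)
  have : 0 < b ^ k := by positivity
  nlinarith

theorem isApproximation_estimate {b : ℝ} (hb0 : 0 < b) (hb1 : b < 1)
    (hq : ∀ u, ∃ e ∈ q.edges, Incident e u) {o : List U} (ho : 0 < o.length) {ε μ : ℝ}
    (hε : 0 < ε) (hμ1 : μ < 1) (hN : 0 < numExtensions q g o fun _ => none) :
    IsApproximation ε μ (estimate q g b o (numRuns b o.length ε μ)).result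
      (numExtensions q g o fun _ => none) := by
  have hx : (walk q g b o fun _ => none).FiniteRuns := finiteRuns_walk q g b _ _
  obtain ⟨hm, hs⟩ := expect_walk (g := g) hb0 hb1 hq o fun _ => none
  have hB := numRuns_bound hb0 hb1 ho hε hμ1
  set N := numExtensions q g o fun _ => none with hNdef
  set h := numRuns b o.length ε μ with hh
  set B := (1 / b) ^ (o.length - 1) with hBdef
  have hNpos : (0 : ℝ) < N := by exact_mod_cast hN
  have hB0 : 0 < B := by positivity
  have h1 : 0 < ε ^ 2 * (1 - μ) := mul_pos (by positivity) (by linarith)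
  have hpos : (0 : ℝ) < h := by
    by_contra hneg
    nlinarith
  have hfin := finiteRuns_estimate q g b o h
  have E1 : (estimate q g b o h).result.expect (fun z => z) = N := by
    rw [expect_result hfin, expect_estimate]
    have e : ∀ s : ℝ, s / h = (h : ℝ)⁻¹ * s := fun s => by ring
    simp only [e, expect_const_mul_self, expect_sumRuns hx, hm]
    field_simp
  have E2 : (estimate q g b o h).result.expect (fun z => z ^ 2) - (N : ℝ) ^ 2 ≤
      (B - 1) * (N : ℝ) ^ 2 / h := by
    rw [expect_result hfin, expect_estimate]
    have e : ∀ s : ℝ, (s / h) ^ 2 = (h : ℝ)⁻¹ ^ 2 * s ^ 2 := fun s => by ring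
    simp only [e, expect_const_mul, expect_sumRuns_sq hx, hm]
    rw [le_div_iff₀ hpos]
    calc _ = ((walk q g b o fun _ => none).expect fun y => y ^ 2) - (N : ℝ) ^ 2 := by
          field_simp
          ring
      _ ≤ _ := by linarith
  have C := PMF.one_sub_div_sq_le_toMeasure (finite_support_result hfin)
    (mul_pos hε hNpos) E1
  refine lt_of_lt_of_le ?_ C
  have : ((estimate q g b o h).result.expect (fun z => z ^ 2) - (N : ℝ) ^ 2) / (ε * N) ^ 2 <
      1 - μ := by
    rw [div_lt_iff₀ (by positivity)]
    refine lt_of_le_of_lt E2 ?_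
    rw [div_lt_iff₀ hpos]
    -- Dropping the -1 that comes from subtracting the squared mean yields the strict inequality
    -- required.
    calc (B - 1) * (N : ℝ) ^ 2 < B * (N : ℝ) ^ 2 := by nlinarith [sq_pos_of_pos hNpos]
      _ ≤ (h * (ε ^ 2 * (1 - μ))) * (N : ℝ) ^ 2 := by gcongr
      _ = _ := by ring
  linarith

end Estimate

end Alley

namespace Alley

open LabeledGraph RandM

variable {U V Λ : Type} {q : LabeledGraph U Λ} {g : LabeledGraph V Λ}

/-! ### Extensions of partial mappings and embeddings -/

theorem IsEmbedding.matches {m : U → V} (hm : IsEmbedding q g m) {e : U × U} (he : e ∈ q.edges) :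
    Matches q g e (m e.1, m e.2) :=
  ⟨(hm.2 e he).1, (hm.2 e he).2, hm.1 _, hm.1 _⟩

/-- Vertex labels are tested only through edges, so every vertex must lie on one. -/
theorem isEmbedding_of_matches (hq : ∀ u, ∃ e ∈ q.edges, Incident e u) {m : U → V}
    (h : ∀ e ∈ q.edges, Matches q g e (m e.1, m e.2)) : IsEmbedding q g m := by
  refine ⟨fun u => ?_, fun e he => ⟨(h e he).1, (h e he).2.1⟩⟩
  obtain ⟨e, he, rfl | rfl⟩ := hq u
  · exact (h e he).2.2.1
  · exact (h e he).2.2.2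

/-- Every query edge both of whose endpoints are mapped is matched. -/
def IsConsistent (q : LabeledGraph U Λ) (g : LabeledGraph V Λ) (p : U → Option V) : Prop :=
  ∀ e ∈ q.edges, ∀ a b, p e.1 = some a → p e.2 = some b → Matches q g e (a, b)

variable [Fintype V]

theorem mem_indexList_of_fst_eq {p : U → Option V} {u : U} {e : U × U} (he : e.1 = u) {v : V} :
    v ∈ indexList q g p u e ↔
      ∃ w, (∀ x, p e.2 = some x → w = x) ∧ Matches q g e (v, w) := by
  rw [indexList, if_pos he]
  cases h : p e.2 <;> simp

theorem mem_indexList_of_fst_ne {p : U → Option V} {u : U} {e : U × U} (he : e.1 ≠ u) {v : V} :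
    v ∈ indexList q g p u e ↔
      ∃ w, (∀ x, p e.1 = some x → w = x) ∧ Matches q g e (w, v) := by
  rw [indexList, if_neg he]
  cases h : p e.1 <;> simp

-- Without self-loops the other endpoint of an edge at u differs from u, so its value is not changed
-- by the update.
open Classical in
theorem IsConsistent.update (hloop : ∀ u, (u, u) ∉ q.edges) {p : U → Option V}
    (hp : IsConsistent q g p) {u : U} {v : V} (hv : v ∈ candidates q g p u) :
    IsConsistent q g (Function.update p u (some v)) := by
  intro e he a b ha hb
  have hne : e.1 ≠ e.2 := fun h => hloop e.1 (by rwa [show (e.1, e.1) = e from Prod.ext rfl h])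
  have hv' := mem_candidates.1 hv e he
  by_cases h1 : e.1 = u
  · have h2 : e.2 ≠ u := fun h => hne (h1.trans h.symm)
    rw [h1, Function.update_self, Option.some_inj] at ha
    rw [Function.update_of_ne h2] at hb
    obtain ⟨w, hw, hM⟩ := (mem_indexList_of_fst_eq h1).1 (hv' (Or.inl h1))
    rw [← ha, ← hw b hb]
    exact hM
  · rw [Function.update_of_ne h1] at ha
    by_cases h2 : e.2 = u
    · rw [h2, Function.update_self, Option.some_inj] at hb
      obtain ⟨w, hw, hM⟩ := (mem_indexList_of_fst_ne h1).1 (hv' (Or.inr h2))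
      rw [← hb, ← hw a ha]
      exact hM
    · rw [Function.update_of_ne h2] at hb
      exact hp e he a b ha hb

theorem IsEmbedding.mem_candidates {m : U → V} (hm : IsEmbedding q g m) {p : U → Option V}
    (hp : ∀ w x, p w = some x → m w = x) (u : U) : m u ∈ candidates q g p u := by
  rw [Alley.mem_candidates]
  intro e he hu
  by_cases h1 : e.1 = u
  · rw [mem_indexList_of_fst_eq h1]
    exact ⟨m e.2, hp _, h1 ▸ IsEmbedding.matches hm he⟩
  · have h2 : e.2 = u := hu.resolve_left h1
    rw [mem_indexList_of_fst_ne h1]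
    exact ⟨m e.1, hp _, h2 ▸ IsEmbedding.matches hm he⟩

-- The embeddings extending p are sorted by the image of the next vertex, which is always a
-- candidate.
open Classical in
theorem numExtensions_eq_card [Fintype U] (hloop : ∀ u, (u, u) ∉ q.edges)
    (hq : ∀ u, ∃ e ∈ q.edges, Incident e u) (us : List U) : ∀ p : U → Option V, us.Nodup →
    (∀ w, p w = none ↔ w ∈ us) → IsConsistent q g p →
    numExtensions q g us p =
      ((embeddings q g).filter fun m => ∀ w x, p w = some x → m w = x).card := by
  induction us with
  | nil =>
    intro p _ hdom hp
    have hsome : ∀ w, ∃ x, p w = some x := fun w =>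
      Option.ne_none_iff_exists'.1 fun h => by simpa using (hdom w).1 h
    choose m hm using hsome
    rw [numExtensions]
    symm
    rw [Finset.card_eq_one]
    refine ⟨m, Finset.ext fun m' => ?_⟩
    simp only [embeddings, Finset.mem_filter, Finset.mem_univ, true_and, Finset.mem_singleton]
    constructor
    · exact fun h => funext fun w => h.2 w _ (hm w)
    · rintro rfl
      refine ⟨isEmbedding_of_matches hq fun e he => hp e he _ _ (hm _) (hm _), fun w x hx => ?_⟩
      rw [hm w] at hx
      exact Option.some_inj.1 hx
  | cons u us ih =>
    intro p hn hdom hp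
    rw [List.nodup_cons] at hn
    have hu : p u = none := (hdom u).2 List.mem_cons_self
    rw [numExtensions, Finset.card_eq_sum_card_fiberwise (f := fun m => m u)
      (t := candidates q g p u)]
    · refine Finset.sum_congr rfl fun v hv => ?_
      rw [ih _ hn.2 _ (hp.update hloop hv), Finset.filter_filter]
      · congr 1
        refine Finset.filter_congr fun m _ => ?_
        constructor
        · intro h
          refine ⟨fun w x hx => h w x ?_, h u v (Function.update_self ..)⟩
          rwa [Function.update_of_ne]
          rintro rfl
          simp [hu] at hx
        · rintro ⟨h, rfl⟩ w x hx
          by_cases hw : w = u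
          · subst hw
            rw [Function.update_self] at hx
            exact Option.some_inj.1 hx
          · rw [Function.update_of_ne hw] at hx
            exact h w x hx
      · intro w
        by_cases hw : w = u
        · subst hw
          simp [hn.1]
        · simp [hdom, hw]
    · intro m hm
      simp only [embeddings, Finset.coe_filter, Finset.mem_filter, Finset.mem_univ, true_and,
        Set.mem_ofPred_eq] at hm
      exact IsEmbedding.mem_candidates hm.1 hm.2 u

theorem numExtensions_eq_card_embeddings [Fintype U] (hloop : ∀ u, (u, u) ∉ q.edges)
    (hq : ∀ u, ∃ e ∈ q.edges, Incident e u) {o : List U} (hn : o.Nodup) (ho : ∀ u, u ∈ o) :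
    numExtensions q g o (fun _ => none) = (embeddings q g).card := by
  rw [numExtensions_eq_card hloop hq o _ hn (by simpa using ho)]
  · simp
  · intro e _ a b ha
    simp at ha

end Alley

/-! ### A Hölder inequality for fractional covers -/

/-- The ratios f/S lie in [0,1], so lowering the exponents to the weights x/X, which sum to 1, only
increases the product. Weighted AM-GM bounds it by a convex combination of ratios, and each ratio
sums to at most 1 over v. -/
theorem Finset.sum_prod_rpow_le_prod_rpow {ι κ : Type*} (E : Finset ι) (P : Finset κ)
    {f : ι → κ → ℝ} {S x : ι → ℝ} (hx : ∀ e ∈ E, 0 ≤ x e) (hx1 : 1 ≤ ∑ e ∈ E, x e)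
    (hS : ∀ e ∈ E, 0 < S e) (hf : ∀ e ∈ E, ∀ v ∈ P, 0 ≤ f e v)
    (hfS : ∀ e ∈ E, ∑ v ∈ P, f e v ≤ S e) :
    ∑ v ∈ P, ∏ e ∈ E, f e v ^ x e ≤ ∏ e ∈ E, S e ^ x e := by
  set X := ∑ e ∈ E, x e with hX
  have hX0 : 0 < X := by linarith
  have key : ∀ v ∈ P, ∏ e ∈ E, (f e v / S e) ^ x e ≤ ∑ e ∈ E, x e / X * (f e v / S e) := by
    intro v hv
    have hb0 : ∀ e ∈ E, 0 ≤ f e v / S e := fun e he => div_nonneg (hf e he v hv) (hS e he).le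
    have hb1 : ∀ e ∈ E, f e v / S e ≤ 1 := fun e he => (div_le_one (hS e he)).2
      ((Finset.single_le_sum (hf e he) hv).trans (hfS e he))
    calc ∏ e ∈ E, (f e v / S e) ^ x e ≤ ∏ e ∈ E, (f e v / S e) ^ (x e / X) := by
          refine Finset.prod_le_prod (fun e he => Real.rpow_nonneg (hb0 e he) _) fun e he => ?_
          -- Base 0 needs care because 0^0 = 1: a zero exponent must stay zero after division by X.
          exact Real.rpow_le_rpow_of_exponent_ge_of_imp (hb0 e he) (hb1 e he)
            (div_le_self (hx e he) hx1) fun _ h => by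
              rw [h, zero_div]
      _ ≤ _ := by
          refine Real.geom_mean_le_arith_mean_weighted _ _ _
            (fun e he => div_nonneg (hx e he) hX0.le) ?_ hb0
          rw [← Finset.sum_div, div_self hX0.ne']
  have hprod : 0 ≤ ∏ e ∈ E, S e ^ x e :=
    Finset.prod_nonneg fun e he => Real.rpow_nonneg (hS e he).le _
  calc ∑ v ∈ P, ∏ e ∈ E, f e v ^ x e
      = (∏ e ∈ E, S e ^ x e) * ∑ v ∈ P, ∏ e ∈ E, (f e v / S e) ^ x e := by
        rw [Finset.mul_sum]
        refine Finset.sum_congr rfl fun v hv => ?_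
        rw [← Finset.prod_mul_distrib]
        refine Finset.prod_congr rfl fun e he => ?_
        rw [← Real.mul_rpow (hS e he).le (div_nonneg (hf e he v hv) (hS e he).le),
          mul_div_cancel₀ _ (hS e he).ne']
    _ ≤ (∏ e ∈ E, S e ^ x e) * 1 := by
        refine mul_le_mul_of_nonneg_left ?_ hprod
        calc _ ≤ ∑ v ∈ P, ∑ e ∈ E, x e / X * (f e v / S e) := Finset.sum_le_sum key
          _ = ∑ e ∈ E, x e / X * ((∑ v ∈ P, f e v) / S e) := by
              rw [Finset.sum_comm]
              simp only [Finset.mul_sum, Finset.sum_div]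
          _ ≤ ∑ e ∈ E, x e / X * 1 := by
              refine Finset.sum_le_sum fun e he => mul_le_mul_of_nonneg_left ?_
                (div_nonneg (hx e he) hX0.le)
              exact (div_le_one (hS e he)).2 (hfS e he)
          _ = 1 := by
              simp only [mul_one]
              rw [← Finset.sum_div, div_self hX0.ne']
    _ = _ := mul_one _

namespace Alley

open LabeledGraph RandM

variable {U V Λ : Type} {q : LabeledGraph U Λ} {g : LabeledGraph V Λ}

/-! ### The AGM bound under partial mappings -/

open Classical in
/-- The data edges that match `e` and are compatible with the partial mapping `p`. -/
noncomputable def relOn (q : LabeledGraph U Λ) (g : LabeledGraph V Λ) (p : U → Option V)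
    (e : U × U) : Finset (V × V) :=
  (rel q g e).filter fun d => (∀ x, p e.1 = some x → d.1 = x) ∧ ∀ x, p e.2 = some x → d.2 = x

theorem mem_relOn {p : U → Option V} {e : U × U} {d : V × V} :
    d ∈ relOn q g p e ↔ Matches q g e d ∧
      (∀ x, p e.1 = some x → d.1 = x) ∧ ∀ x, p e.2 = some x → d.2 = x := by
  classical
  rw [relOn, Finset.mem_filter, rel, Finset.mem_filter]
  exact and_congr_left fun _ => ⟨fun h => h.2, fun h => ⟨h.1, h⟩⟩

theorem relOn_none (e : U × U) : relOn q g (fun _ => none) e = rel q g e := by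
  simp [relOn]

-- The value v can be read off from the endpoint of a data edge on the side of u, so the restricted
-- relations are disjoint.
open Classical in
theorem sum_card_relOn_update_le {p : U → Option V} {u : U} (hu : p u = none) {e : U × U}
    (he : Incident e u) (P : Finset V) :
    ∑ v ∈ P, (relOn q g (Function.update p u (some v)) e).card ≤ (relOn q g p e).card := by
  have hmono : ∀ v, ∀ d ∈ relOn q g (Function.update p u (some v)) e, d ∈ relOn q g p e := by
    intro v d hd
    rw [mem_relOn] at hd ⊢
    have h : ∀ w x, p w = some x → Function.update p u (some v) w = some x := by
      intro w x hx
      rwa [Function.update_of_ne]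
      rintro rfl
      simp [hu] at hx
    exact ⟨hd.1, fun x hx => hd.2.1 x (h _ _ hx), fun x hx => hd.2.2 x (h _ _ hx)⟩
  obtain ⟨φ, hφ⟩ : ∃ φ : V × V → V,
      ∀ v, ∀ d ∈ relOn q g (Function.update p u (some v)) e, φ d = v := by
    rcases he with rfl | rfl
    · exact ⟨Prod.fst, fun v d hd => (mem_relOn.1 hd).2.1 v (Function.update_self ..)⟩
    · exact ⟨Prod.snd, fun v d hd => (mem_relOn.1 hd).2.2 v (Function.update_self ..)⟩
  rw [← Finset.card_biUnion]
  · exact Finset.card_le_card (Finset.biUnion_subset.2 fun v _ d hd => hmono v d hd)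
  · intro v _ v' _ hne
    exact Finset.disjoint_left.2 fun d hd hd' => hne ((hφ v d hd).symm.trans (hφ v' d hd'))

open Classical in
theorem relOn_update_of_not_incident {p : U → Option V} {u : U} {e : U × U}
    (he : ¬ Incident e u) (v : V) :
    relOn q g (Function.update p u (some v)) e = relOn q g p e := by
  rw [Incident, not_or] at he
  ext d
  rw [mem_relOn, mem_relOn, Function.update_of_ne he.1, Function.update_of_ne he.2]

/-- The product that bounds the number of extensions of `p`, for the cover `x`. -/
noncomputable def potential (q : LabeledGraph U Λ) (g : LabeledGraph V Λ) (x : U × U → ℝ)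
    (p : U → Option V) : ℝ :=
  ∏ e ∈ q.edges, ((relOn q g p e).card : ℝ) ^ x e

theorem one_le_card_rpow {s : Finset (V × V)} (hs : s.Nonempty) {x : ℝ} (hx : 0 ≤ x) :
    1 ≤ (s.card : ℝ) ^ x :=
  Real.one_le_rpow (by exact_mod_cast hs.card_pos) hx

theorem one_le_potential {x : U × U → ℝ} (hx : IsFractionalEdgeCover q x) {p : U → Option V}
    (hp : ∀ e ∈ q.edges, (relOn q g p e).Nonempty) : 1 ≤ potential q g x p :=
  Finset.one_le_prod fun e he => one_le_card_rpow (hp e he) (hx.1 e he)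

-- Edges not at u are unaffected and factor out. For those at u the cover condition says that the
-- exponents sum to at least 1, which is what the Hölder inequality asks for.
open Classical in
theorem sum_potential_update_le {x : U × U → ℝ} (hx : IsFractionalEdgeCover q x)
    {p : U → Option V} (hp : ∀ e ∈ q.edges, (relOn q g p e).Nonempty) {u : U} (hu : p u = none)
    (P : Finset V) :
    ∑ v ∈ P, potential q g x (Function.update p u (some v)) ≤ potential q g x p := by
  simp only [potential]
  simp only [← Finset.prod_filter_mul_prod_filter_not q.edges (fun e => Incident e u)]
  have h : ∀ v, ∏ e ∈ q.edges.filter (fun e => ¬ Incident e u),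
      ((relOn q g (Function.update p u (some v)) e).card : ℝ) ^ x e =
      ∏ e ∈ q.edges.filter (fun e => ¬ Incident e u), ((relOn q g p e).card : ℝ) ^ x e := by
    intro v
    refine Finset.prod_congr rfl fun e he => ?_
    rw [relOn_update_of_not_incident (Finset.mem_filter.1 he).2]
  simp only [h, ← Finset.sum_mul]
  refine mul_le_mul_of_nonneg_right ?_
    (Finset.prod_nonneg fun e _ => Real.rpow_nonneg (Nat.cast_nonneg _) _)
  refine Finset.sum_prod_rpow_le_prod_rpow _ _ (fun e he => hx.1 e (Finset.mem_filter.1 he).1)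
    (hx.2 u) (fun e he => ?_) (fun e _ v _ => Nat.cast_nonneg _) fun e he => ?_
  · exact_mod_cast (hp e (Finset.mem_filter.1 he).1).card_pos
  · exact_mod_cast sum_card_relOn_update_le hu (Finset.mem_filter.1 he).2 P

/-! ### Running time of repeated computations -/

theorem runsIn_sumOver {f : V → RandM ℝ} {B : V → ℝ} (S : List V)
    (hf : ∀ v ∈ S, (f v).RunsIn (B v) fun _ => True) :
    (sumOver f S).RunsIn (S.map fun v => 4 + B v).sum fun _ => True := by
  induction S with
  | nil => exact (runsIn_pure (Q := fun _ => True) trivial).mono (by simp) fun _ h => h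
  | cons v S ih =>
    rw [sumOver]
    refine ((runsIn_step 3).bind fun _ _ => (hf v List.mem_cons_self).bind fun _ _ =>
      (ih fun w hw => hf w (List.mem_cons_of_mem _ hw)).bind fun _ _ =>
      (runsIn_step 1).bind fun _ _ => runsIn_pure (Q := fun _ => True) trivial).mono ?_ fun _ h => h
    rw [List.map_cons, List.sum_cons]
    push_cast
    linarith

theorem runsIn_sumRuns {x : RandM ℝ} {B : ℝ} (hx : x.RunsIn B fun _ => True) (h : ℕ) :
    (sumRuns x h).RunsIn (h * (B + 2)) fun _ => True := by
  induction h with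
  | zero => exact (runsIn_pure (Q := fun _ => True) trivial).mono (by simp) fun _ h => h
  | succ h ih =>
    rw [sumRuns]
    refine ((runsIn_step 1).bind fun _ _ => hx.bind fun _ _ => ih.bind fun _ _ =>
      (runsIn_step 1).bind fun _ _ => runsIn_pure (Q := fun _ => True) trivial).mono ?_ fun _ h => h
    push_cast
    linarith

/-! ### Candidates and the potential -/

variable [Fintype V]

/-- As u is unmapped, the index list is contained in a projection of the compatible relation. -/
theorem card_indexList_le {p : U → Option V} {u : U} (hu : p u = none) {e : U × U}
    (he : Incident e u) : (indexList q g p u e).card ≤ (relOn q g p e).card := by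
  classical
  by_cases h1 : e.1 = u
  · refine (Finset.card_le_card (t := (relOn q g p e).image Prod.fst) fun v hv => ?_).trans
      Finset.card_image_le
    obtain ⟨w, hw, hM⟩ := (mem_indexList_of_fst_eq h1).1 hv
    exact Finset.mem_image.2 ⟨(v, w), mem_relOn.2 ⟨hM, by simp [h1, hu], hw⟩, rfl⟩
  · have h2 : e.2 = u := he.resolve_left h1
    refine (Finset.card_le_card (t := (relOn q g p e).image Prod.snd) fun v hv => ?_).trans
      Finset.card_image_le
    obtain ⟨w, hw, hM⟩ := (mem_indexList_of_fst_ne h1).1 hv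
    exact Finset.mem_image.2 ⟨(w, v), mem_relOn.2 ⟨hM, hw, by simp [h2, hu]⟩, rfl⟩

-- Candidates are tested against every incident edge, including those to vertices not yet mapped.
-- Thus even a branch that dies later has potential at least 1, which pays for its constant
-- overhead.
open Classical in
theorem relOn_update_nonempty (hloop : ∀ u, (u, u) ∉ q.edges) {p : U → Option V}
    (hp : ∀ e ∈ q.edges, (relOn q g p e).Nonempty) {u : U} {v : V}
    (hv : v ∈ candidates q g p u) :
    ∀ e ∈ q.edges, (relOn q g (Function.update p u (some v)) e).Nonempty := by
  intro e he
  by_cases hi : Incident e u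
  · have hne : e.1 ≠ e.2 := fun h => hloop e.1 (by rwa [show (e.1, e.1) = e from Prod.ext rfl h])
    have hv' := mem_candidates.1 hv e he hi
    by_cases h1 : e.1 = u
    · have h2 : e.2 ≠ u := fun h => hne (h1.trans h.symm)
      obtain ⟨w, hw, hM⟩ := (mem_indexList_of_fst_eq h1).1 hv'
      refine ⟨(v, w), mem_relOn.2 ⟨hM, ?_, ?_⟩⟩
      · simp [h1]
      · rwa [Function.update_of_ne h2]
    · have h2 : e.2 = u := hi.resolve_left h1
      obtain ⟨w, hw, hM⟩ := (mem_indexList_of_fst_ne h1).1 hv'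
      refine ⟨(w, v), mem_relOn.2 ⟨hM, ?_, ?_⟩⟩
      · rwa [Function.update_of_ne h1]
      · simp [h2]
  · rw [relOn_update_of_not_incident hi]
    exact hp e he

/-- For m ≥ 1 the cover condition at u gives m ≤ ∏ m^{x_e} over the edges at u, and m is at most
each of their compatible relations. The remaining factors are at least 1. -/
theorem le_potential {x : U × U → ℝ} (hx : IsFractionalEdgeCover q x)
    {p : U → Option V} (hp : ∀ e ∈ q.edges, (relOn q g p e).Nonempty) {u : U} (hu : p u = none)
    {m : ℕ} (hm : ∀ e ∈ q.edges, Incident e u → m ≤ (indexList q g p u e).card) :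
    (m : ℝ) ≤ potential q g x p := by
  classical
  rcases Nat.eq_zero_or_pos m with rfl | hm0
  · have := one_le_potential hx hp
    push_cast
    linarith
  have hm1 : (1 : ℝ) ≤ m := by exact_mod_cast hm0
  rw [potential, ← Finset.prod_filter_mul_prod_filter_not q.edges (fun e => Incident e u)]
  calc (m : ℝ) = (m : ℝ) ^ (1 : ℝ) := (Real.rpow_one _).symm
    _ ≤ (m : ℝ) ^ (∑ e ∈ q.edges.filter (fun e => Incident e u), x e) :=
        Real.rpow_le_rpow_of_exponent_le hm1 (by convert hx.2 u)
    _ = ∏ e ∈ q.edges.filter (fun e => Incident e u), (m : ℝ) ^ x e :=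
        Real.rpow_sum_of_pos (by linarith) _ _
    _ ≤ ∏ e ∈ q.edges.filter (fun e => Incident e u), ((relOn q g p e).card : ℝ) ^ x e := by
        refine Finset.prod_le_prod (fun e _ => Real.rpow_nonneg (by linarith) _) fun e he => ?_
        rw [Finset.mem_filter] at he
        refine Real.rpow_le_rpow (by linarith) ?_ (hx.1 e he.1)
        exact_mod_cast (hm e he.1 he.2).trans (card_indexList_le hu he.2)
    _ ≤ _ := by
        refine le_mul_of_one_le_right
          (Finset.prod_nonneg fun e _ => Real.rpow_nonneg (Nat.cast_nonneg _) _) ?_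
        refine Finset.one_le_prod fun e he => ?_
        have he' := (Finset.mem_filter.1 he).1
        exact one_le_card_rpow (hp e he') (hx.1 e he')

/-! ### Running time of the random walk -/

-- At a sampled level the work is (3D + 2)W for the intersection, 5W for drawing, 4W for the calls
-- and 4 ≤ 4W for the rest, where D = |U|² bounds the number of query edges at a vertex. This is (3D
-- + 15)W in total, and the recursive calls add at most K·W.
open Classical in
theorem runsIn_walk [Fintype U] {b : ℝ} (hb0 : 0 < b) (hb1 : b < 1)
    (hloop : ∀ u, (u, u) ∉ q.edges) (hq : ∀ u, ∃ e ∈ q.edges, Incident e u)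
    {x : U × U → ℝ} (hx : IsFractionalEdgeCover q x) (us : List U) :
    ∀ p : U → Option V, us.Nodup → (∀ w ∈ us, p w = none) →
    (∀ e ∈ q.edges, (relOn q g p e).Nonempty) →
    (walk q g b us p).RunsIn
      (us.length * (3 * (Fintype.card U : ℝ) ^ 2 + 15) * potential q g x p) fun _ => True := by
  induction us with
  | nil =>
    intro p _ _ _
    exact (runsIn_pure (Q := fun _ => True) trivial).mono (by simp) fun _ h => h
  | cons u us ih =>
    intro p hn hdom hp
    rw [List.nodup_cons] at hn
    have hu := hdom u List.mem_cons_self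
    obtain ⟨r, k, h, hrn, hl, hs, hmem, m, hm, hk⟩ := law_intersect_indexLists (g := g) hq p u
    have hW1 := one_le_potential hx hp
    have hmW := le_potential hx hp hu hm
    have hsum := sum_potential_update_le hx hp hu (candidates q g p u)
    have hup : ∀ v ∈ candidates q g p u, ∀ e ∈ q.edges,
        (relOn q g (Function.update p u (some v)) e).Nonempty :=
      fun v hv => relOn_update_nonempty hloop hp hv
    set W := potential q g x p with hW
    set D : ℝ := (Fintype.card U : ℝ) ^ 2 with hD
    have hLD : ((indexLists q g p u).length : ℝ) ≤ D := by
      have h1 : (indexLists q g p u).length ≤ Fintype.card U ^ 2 := by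
        rw [indexLists, List.length_map, Finset.length_toList, pow_two, ← Fintype.card_prod]
        exact Finset.card_le_univ _
      rw [hD]
      exact_mod_cast h1
    have hkW : (k : ℝ) ≤ (3 * D + 2) * W := by
      have h1 : (k : ℝ) ≤ 2 * ((indexLists q g p u).length : ℝ) +
          m * (((indexLists q g p u).length : ℝ) + 2) := by exact_mod_cast hk
      have h2 : (m : ℝ) * (((indexLists q g p u).length : ℝ) + 2) ≤ W * (D + 2) := by gcongr
      have hD0 : 0 ≤ D := by positivity
      nlinarith
    have hint := runsIn_of_law_eq_pure h (Q := fun s => s = r) hkW rfl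
    have hD0 : 0 ≤ D := by positivity
    cases us with
    | nil =>
      rw [walk]
      refine (hint.bind fun s _ => (runsIn_step 1).bind fun _ _ =>
        runsIn_pure (Q := fun _ => True) trivial).mono ?_ fun _ h => h
      simp only [List.length_singleton]
      push_cast
      nlinarith
    | cons u' us =>
      set K : ℝ := ((u' :: us).length : ℝ) * (3 * D + 15) with hK
      have hK0 : 0 ≤ K := by positivity
      have hrec : ∀ v ∈ r, (walk q g b (u' :: us) (Function.update p u (some v))).RunsIn
          (K * potential q g x (Function.update p u (some v))) fun _ => True := by
        intro v hv
        refine ih _ hn.2 (fun w hw => ?_) (hup v ((hmem v).1 hv))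
        rw [Function.update_of_ne]
        · exact hdom w (List.mem_cons_of_mem _ hw)
        · rintro rfl
          exact hn.1 hw
      have hone : ∀ v ∈ r, 1 ≤ potential q g x (Function.update p u (some v)) :=
        fun v hv => one_le_potential hx (hup v ((hmem v).1 hv))
      -- The overhead 4 per call is absorbed by potentials at least 1. Enlarging the sample to all
      -- candidates then permits the Hölder bound.
      have hsumr : ∀ S : List V, S.Subperm r → (S.map fun v => 4 +
          K * potential q g x (Function.update p u (some v))).sum ≤ (4 + K) * W := by
        rintro S ⟨S', hS', hsub⟩
        rw [← (hS'.map _).sum_eq]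
        calc _ ≤ (r.map fun v => 4 + K * potential q g x (Function.update p u (some v))).sum := by
              refine (hsub.map _).sum_le_sum fun y hy => ?_
              obtain ⟨v, hv, rfl⟩ := List.mem_map.1 hy
              have := hone v hv
              positivity
          _ ≤ (r.map fun v => (4 + K) * potential q g x (Function.update p u (some v))).sum :=
              List.sum_le_sum fun v hv => by
                have := hone v hv
                linarith
          _ ≤ _ := by
              rw [hs, ← Finset.mul_sum]
              gcongr
      have hrW : (r.length : ℝ) ≤ W := by
        rw [hl, Finset.card_eq_sum_ones]
        push_cast
        exact (Finset.sum_le_sum fun v hv => hone v ((hmem v).2 hv)).trans hsum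
      have htr : ((⌈b * (r.length : ℝ)⌉₊ : ℕ) : ℝ) ≤ r.length := by
        exact_mod_cast Nat.ceil_le.2
          (mul_le_of_le_one_left (Nat.cast_nonneg r.length) hb1.le)
      rw [walk]
      refine (hint.bind (B' := 2 + (5 * W + ((4 + K) * W + 2))) (Q' := fun _ => True) ?_).mono ?_
        fun _ h => h
      · rintro s rfl
        refine ((runsIn_step 2).bind fun _ _ => ((runsIn_sample _ _).mono
          (B' := 5 * W) ?_ fun _ h => h).bind fun S hS => ((runsIn_sumOver S fun v hv =>
            hrec v (hS.subset hv)).mono (hsumr S hS) fun _ h => h).bind fun _ _ =>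
            (runsIn_step 2).bind fun _ _ => runsIn_pure (Q := fun _ => True) trivial).mono ?_
              fun _ h => h
        · linarith
        · push_cast
          linarith
      · have e : (((u :: u' :: us).length : ℕ) : ℝ) * (3 * D + 15) = K + (3 * D + 15) := by
          rw [hK, List.length_cons]
          push_cast
          ring
        rw [e]
        nlinarith

theorem timeLE_estimate_AGM [Fintype U] {b : ℝ} (hb0 : 0 < b) (hb1 : b < 1)
    (hloop : ∀ u, (u, u) ∉ q.edges) (hq : ∀ u, ∃ e ∈ q.edges, Incident e u) {o : List U}
    (hn : o.Nodup) (hR : ∀ e ∈ q.edges, (rel q g e).Nonempty) (h : ℕ) :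
    (estimate q g b o h).TimeLE
      ((h * (o.length * (3 * (Fintype.card U : ℝ) ^ 2 + 15) + 2) + 1) * AGM q g) := by
  classical
  set K : ℝ := o.length * (3 * (Fintype.card U : ℝ) ^ 2 + 15) with hK
  have hC : 0 < (h : ℝ) * (K + 2) + 1 := by positivity
  intro r hr
  rw [← div_le_iff₀' hC]
  -- The bound is proved for every cover separately. The all-ones cover, valid as no vertex is
  -- isolated, shows that the set under the infimum is nonempty.
  refine le_csInf ⟨_, fun _ => 1, ⟨fun _ _ => zero_le_one, fun u => ?_⟩, rfl⟩ ?_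
  · obtain ⟨e, he, hu⟩ := hq u
    exact Finset.single_le_sum (f := fun _ => (1 : ℝ)) (fun _ _ => zero_le_one)
      (Finset.mem_filter.2 ⟨he, hu⟩)
  · rintro c ⟨x, hx, rfl⟩
    have hp : ∀ e ∈ q.edges, (relOn q g (fun _ => none) e).Nonempty := by simpa [relOn_none] using hR
    have h1 := one_le_potential hx hp
    have hw := runsIn_walk hb0 hb1 hloop hq hx o _ hn (fun _ _ => rfl) hp
    have hW : potential q g x (fun _ => none) =
        ∏ e ∈ q.edges, ((rel q g e).card : ℝ) ^ x e := by simp only [potential, relOn_none]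
    rw [hW] at h1 hw
    set W := ∏ e ∈ q.edges, ((rel q g e).card : ℝ) ^ x e
    have hrun : (estimate q g b o h).RunsIn (h * (K * W + 2) + ((1 : ℕ) + 0)) fun _ => True := by
      rw [estimate]
      exact (runsIn_sumRuns hw h).bind fun _ _ => (runsIn_step 1).bind fun _ _ =>
        runsIn_pure trivial
    rw [div_le_iff₀' hC]
    refine (hrun.timeLE r hr).trans ?_
    have : (0 : ℝ) ≤ h := Nat.cast_nonneg h
    push_cast
    nlinarith

end Alley

/-! ### The main theorem -/

theorem theorem1 (b : ℝ) (hb0 : 0 < b) (hb1 : b < 1) (n : ℕ) (hn : 0 < n)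
    (ε μ : ℝ) (hε : 0 < ε) (hμ0 : 0 < μ) (hμ1 : μ < 1) :
    ∃ C : ℝ, ∀ (U V Λ : Type) [Fintype U] [Fintype V]
      (q : LabeledGraph U Λ) (g : LabeledGraph V Λ) (o : List U),
      Fintype.card U = n →
      (∀ u, (u, u) ∉ q.edges) →
      (∀ u, ∃ e ∈ q.edges, LabeledGraph.Incident e u) →
      o.Nodup → (∀ u, u ∈ o) →
      (0 < (LabeledGraph.embeddings q g).card →
        Alley.IsApproximation ε μ (Alley.estimate q g b o (Alley.numRuns b n ε μ)).result
          (LabeledGraph.embeddings q g).card) ∧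
      ((∀ e ∈ q.edges, (LabeledGraph.rel q g e).Nonempty) →
        (Alley.estimate q g b o (Alley.numRuns b n ε μ)).TimeLE (C * LabeledGraph.AGM q g)) := by
  refine ⟨Alley.numRuns b n ε μ * (n * (3 * (n : ℝ) ^ 2 + 15) + 2) + 1, ?_⟩
  intro U V Λ _ _ q g o hU hloop hq hnd hall
  have ho : o.length = n := by
    classical
    rw [← hU, ← List.toFinset_card_of_nodup hnd, ← Finset.card_univ]
    congr 1
    ext u
    simp [hall u]
  constructor
  · intro hM
    rw [← Alley.numExtensions_eq_card_embeddings hloop hq hnd hall] at hM ⊢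
    rw [← ho] at hn ⊢
    exact Alley.isApproximation_estimate hb0 hb1 hq hn hε hμ1 hM
  · intro hR
    have := Alley.timeLE_estimate_AGM hb0 hb1 hloop hq hnd hR (Alley.numRuns b n ε μ)
    rwa [ho, hU] at this
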